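/- **Setting.** Let $K$ be an $I\times J$ matrix with entries in $\{0,1\}$ ($K_{i,j}=1$ if jobs of type $j$ need resource $i$), such that for every $i$ there is a $j$ with $K_{i,j}=1$ and $K_{l,j}=0$ for all $l\ne i$; let $h\in(0,\infty)^J$. For each $r\in\mathbb N=\{1,2,\dots\}$ let $u^r_j(l)$, $v^r_j(l)$ ($1\le j\le J$, $l\ge1$), random variables on a probability space $(\Omega,\mathcal F,P)$, be the interarrival times and job sizes of the $r$-th system: mutually independent, almost surely positive, identically distributed in $l$, with means $1/\alpha^r_j$, $1/\beta^r_j$ and finite standard deviations $\sigma^{u,r}_j,\sigma^{v,r}_j$. Assume: * there is $\delta>0$ with $\sup_{r}E[e^{yv^r_j(1)}]<\infty$ and $\sup_rE[e^{yu^r_j(1)}]<\infty$ for all $y<\delta$ and all $j$; * for each $j$ there are $\alpha_j,\beta_j,\bar\alpha_j,\bar\beta_j,\sigma^u_j,\sigma^v_j\in(0,\infty)$ with $r(\alpha^r_j-\alpha_j)\to\bar\alpha_j$, $r(\beta^r_j-\beta_j)\to\bar\beta_j$, $\sigma^{u,r}_j\to\sigma^u_j$, $\sigma^{v,r}_j\to\sigma^v_j$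 as $r\to\infty$; with $\rho_j=\alpha_j/\beta_j$ the vector of capacities is $C=K\rho$; and with $\eta_j=\beta_j^{-2}(\bar\alpha_j\beta_j-\alpha_j\bar\beta_j)$ all entries of $K\eta$ are negative. **Policy parameters.** Products of vectors are componentwise; $\rho^*=\min_j\rho_j$. Let $\mathcal C=\{w\in\ker K:(h\beta)\cdot w=0\}$. If $\mathcal C\ne\ker K$, let $e\in\ker K$ be the unit vector orthogonal to $\mathcal C$ with $(h\beta)\cdot e<0$, and let $\mathcal M$ be the set of $z\in\{0,1\}^J$ for which some $w\in\ker K$ satisfies $w\cdot e>0$ and $w_j\ge0$ whenever $z_j=1$. If $\mathcal C=\ker K$, let $\mathcal M=\emptyset$. For $z\in\mathcal M$ fix $v^c(z)\in\ker K$ with $v^c(z)\cdot e>0$, with $v^c_j(z)\ge0$ whenever $z_j=1$, and with $\rho_j-v^c_j(z)>\rho^*/2$ for all $j$. Let $\tilde\lambda=\max_{z\in\mathcal M}(h\beta)\cdot v^c(z)$. For every $z\in\{0,1\}^J$ fix $v^b(z)\in\mathbb R^J$ with $|v^b(z)|\le\min\{\rho^*/4,\ |\tilde\lambda|/(4|\beta||h|)\}$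 (only $|v^b(z)|\le\rho^*/4$ if $\mathcal M=\emptyset$; $|\cdot|$ is the maximum norm), with $v^b_j(z)>0$ whenever $z_j=1$, and with $(Kv^b(z))_i=0$ for every $i$ for which there is a $j$ with $K_{i,j}=1$ and $z_j=0$. Let $c_1<c_2$, $0<\kappa<1/4$, $\tilde c_1=c_1\min_j\beta_j$ and $\tilde c_2=c_2\min_j\beta_j$. **Processes.** An initial state of the $r$-th system is $y^r=(\hat q^r,(\hat\Upsilon^{A,r},\hat\Upsilon^{S,r}),\tilde{\mathcal E}^r)\in(\tfrac1r\mathbb N_0)^J\times[0,\infty)^{2J}\times\{0,1\}^J$. Put $q^r=r\hat q^r$, $\Upsilon^{A,r}=r\hat\Upsilon^{A,r}$, $\Upsilon^{S,r}=r\hat\Upsilon^{S,r}$, $A^r_j(s)=\max\{n\ge0:\sum_{l=1}^nu^r_j(l)\le s\}$ and $S^r_j(s)=\max\{n\ge0:\sum_{l=1}^nv^r_j(l)\le s\}$. Under the policy, the queue lengths $Q^r$ and the cumulative allocations $B^r$, started from $y^r$, satisfy almost surely, for all $t\ge0$ and all $j$, $$Q^r_j(t)=q^r_j+A^r_j\big((t-\Upsilon^{A,r}_j)^+\big)+\mathbf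 1_{\{t\ge\Upsilon^{A,r}_j>0\}}-S^r_j\big((B^r_j(t)-\Upsilon^{S,r}_j)^+\big)-\mathbf 1_{\{B^r_j(t)\ge\Upsilon^{S,r}_j>0\}},\qquad B^r_j(t)=\int_0^t\mathfrak b^r_j(s)\,ds,$$ $$\mathfrak b^r_j(t)=\mathbf 1_{\{\mathcal E^r_j(t)=0\}}\Big(\rho_j-v^c_j(\mathcal Z^r(t))\mathbf 1_{\{\mathcal Z^r(t)\in\mathcal M\}}-v^b_j(\mathcal Z^r(t))\Big),\qquad\mathcal Z^r_j(t)=\mathbf 1_{\{Q^r_j(t)<\tilde c_2r^\kappa\}}.$$ Here $\mathcal E^r_j(t)=1$ (processing of type $j$ is stopped) if $t\in\bigcup_{l\ge1}[\tau_{2l-1},\tau_{2l})$, and $\mathcal E^r_j(t)=0$ otherwise, where $\tau_1=0$ if $\tilde{\mathcal E}^r_j=1$, $\tau_1=\inf\{t\ge0:Q^r_j(t)<\tilde c_1r^\kappa\}$ if $\tilde{\mathcal E}^r_j=0$, and, for $l\ge1$, $\tau_{2l}=\inf\{t\ge\tau_{2l-1}:Q^r_j(t)\ge\tilde c_2r^\kappa\}$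 and $\tau_{2l+1}=\inf\{t\ge\tau_{2l}:Q^r_j(t)<\tilde c_1r^\kappa\}$ (with $\inf\emptyset=\infty$). **Proposition 3.3.** For each $\epsilon>0$ there are $B,R\in(0,\infty)$ such that for all $r\ge R$, all initial states $y^r$, all $T\ge1$ and all $j\in\{1,\dots,J\}$, $$P_{y^r}\Big(\int_0^{r^2T}\mathbf 1_{\{\mathcal E^r_j(s)=1\}}\,ds\ \ge\ r\hat\Upsilon^{A,r}_j+\epsilon\,T\,r^{\frac74\kappa}\Big)\ \le\ e^{-B\,T\,r^{\kappa/8}},$$ where $P_{y^r}$ is the probability when the system starts from $y^r$. -/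

import Mathlib

open MeasureTheory ProbabilityTheory Filter Topology
open scoped Matrix ENNReal

noncomputable section

namespace RSN

/-- Parameters of a resource sharing network with `I` resources and `J` job types:
incidence matrix `K`, capacities `C`, limiting arrival and service rates `α`, `β`, the
second-order limits `αbar`, `βbar`, the limiting standard deviations `σu`, `σv` of the
interarrival times and job sizes, and the holding cost vector `h`. -/
structure Network (I J : ℕ) where
  K : Matrix (Fin I) (Fin J) ℝ
  C : Fin I → ℝ
  α : Fin J → ℝ
  β : Fin J → ℝ
  αbar : Fin J → ℝ
  βbar : Fin J → ℝ
  σu : Fin J → ℝ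
  σv : Fin J → ℝ
  h : Fin J → ℝ

/-- The stochastic input of the whole sequence of systems. `u r j l` and `v r j l` are the
`(l+1)`-st interarrival time and job size of type `j` in the `r`-th system, `r = 1, 2, …`
(the index `r = 0` is never used); `αr r j` and `βr r j` are the arrival and service rates. -/
structure Input (Ω : Type*) (J : ℕ) where
  u : ℕ → Fin J → ℕ → Ω → ℝ
  v : ℕ → Fin J → ℕ → Ω → ℝ
  αr : ℕ → Fin J → ℝ
  βr : ℕ → Fin J → ℝ

/-- For every `r`, the interarrival times and job sizes are i.i.d. in `l`, mutually independent,
almost surely positive, with means `1 / αr`, `1 / βr` and finite standard deviations. -/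
structure Input.IsRenewal {Ω : Type*} [MeasurableSpace Ω] {J : ℕ} (D : Input Ω J)
    (P : Measure Ω) : Prop where
  meas_u : ∀ r j l, 1 ≤ r → Measurable (D.u r j l)
  meas_v : ∀ r j l, 1 ≤ r → Measurable (D.v r j l)
  pos_u : ∀ r j l, 1 ≤ r → ∀ᵐ ω ∂P, 0 < D.u r j l ω
  pos_v : ∀ r j l, 1 ≤ r → ∀ᵐ ω ∂P, 0 < D.v r j l ω
  ident_u : ∀ r j l, 1 ≤ r → IdentDistrib (D.u r j l) (D.u r j 0) P P
  ident_v : ∀ r j l, 1 ≤ r → IdentDistrib (D.v r j l) (D.v r j 0) P P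
  indep : ∀ r, 1 ≤ r → iIndepFun
    (fun x : (Fin J × ℕ) ⊕ (Fin J × ℕ) =>
      Sum.elim (fun p => D.u r p.1 p.2) (fun p => D.v r p.1 p.2) x) P
  memLp_u : ∀ r j, 1 ≤ r → MemLp (D.u r j 0) 2 P
  memLp_v : ∀ r j, 1 ≤ r → MemLp (D.v r j 0) 2 P
  αr_pos : ∀ r j, 1 ≤ r → 0 < D.αr r j
  βr_pos : ∀ r j, 1 ≤ r → 0 < D.βr r j
  mean_u : ∀ r j, 1 ≤ r → ∫ ω, D.u r j 0 ω ∂P = 1 / D.αr r j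
  mean_v : ∀ r j, 1 ≤ r → ∫ ω, D.v r j 0 ω ∂P = 1 / D.βr r j

/-- Exponential moments near the origin, uniformly in `r`. -/
def Input.MgfBound {Ω : Type*} [MeasurableSpace Ω] {J : ℕ} (D : Input Ω J)
    (P : Measure Ω) : Prop :=
  ∃ δ : ℝ, 0 < δ ∧ ∀ y : ℝ, y < δ → ∀ j : Fin J,
    (⨆ (r : ℕ) (_ : 1 ≤ r), ∫⁻ ω, ENNReal.ofReal (Real.exp (y * D.v r j 0 ω)) ∂P) < ⊤ ∧
    (⨆ (r : ℕ) (_ : 1 ≤ r), ∫⁻ ω, ENNReal.ofReal (Real.exp (y * D.u r j 0 ω)) ∂P) < ⊤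

namespace Network

variable {I J : ℕ} (N : Network I J)

/-- The asymptotic load `ρ = α / β`. -/
def ρ (j : Fin J) : ℝ := N.α j / N.β j

/-- `η = β⁻² (αbar β - α βbar)`, the limit of `r (ρ^r - ρ)`. -/
def η (j : Fin J) : ℝ := (N.αbar j * N.β j - N.α j * N.βbar j) / N.β j ^ 2

/-- `ρ* = min_j ρ_j`. -/
def ρmin : ℝ := ⨅ j, N.ρ j

/-- `min_j β_j`. -/
def βmin : ℝ := ⨅ j, N.β j

/-- The componentwise product `h β`. -/
def hβ (j : Fin J) : ℝ := N.h j * N.β j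

/-- `K` is an incidence matrix and the holding costs are positive. -/
structure Basic : Prop where
  K_entries : ∀ i j, N.K i j = 0 ∨ N.K i j = 1
  h_pos : ∀ j, 0 < N.h j

/-- The heavy traffic condition, including the stability condition `K η < 0`. -/
structure HeavyTraffic {Ω : Type*} [MeasurableSpace Ω] (D : Input Ω J) (P : Measure Ω) :
    Prop where
  α_pos : ∀ j, 0 < N.α j
  β_pos : ∀ j, 0 < N.β j
  αbar_pos : ∀ j, 0 < N.αbar j
  βbar_pos : ∀ j, 0 < N.βbar j
  σu_pos : ∀ j, 0 < N.σu j
  σv_pos : ∀ j, 0 < N.σv j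
  tendsto_α : ∀ j, Tendsto (fun r : ℕ => (r : ℝ) * (D.αr r j - N.α j)) atTop (𝓝 (N.αbar j))
  tendsto_β : ∀ j, Tendsto (fun r : ℕ => (r : ℝ) * (D.βr r j - N.β j)) atTop (𝓝 (N.βbar j))
  tendsto_σu : ∀ j, Tendsto (fun r : ℕ => Real.sqrt (variance (D.u r j 0) P)) atTop
    (𝓝 (N.σu j))
  tendsto_σv : ∀ j, Tendsto (fun r : ℕ => Real.sqrt (variance (D.v r j 0) P)) atTop
    (𝓝 (N.σv j))
  capacity : N.C = N.K *ᵥ N.ρ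
  stable : ∀ i, (N.K *ᵥ N.η) i < 0

/-- Local traffic: each resource has a job type that uses this resource only. -/
def LocalTraffic : Prop :=
  ∀ i, ∃ j, N.K i j = 1 ∧ ∀ l, l ≠ i → N.K l j = 0

/-- The subspace of `w ∈ ker K` with `(h β) · w = 0`. -/
def costKer : Set (Fin J → ℝ) := {w | N.K *ᵥ w = 0 ∧ N.hβ ⬝ᵥ w = 0}

/-- The nontrivial case: `costKer` is a proper subspace of `ker K`. -/
def Nontrivial : Prop := ∃ w, N.K *ᵥ w = 0 ∧ w ∉ N.costKer

/-- In the nontrivial case `e` is the distinguished element of the orthonormal basis: a unit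
vector of `ker K`, orthogonal to `costKer`, with `(h β) · e < 0`.
(No requirement, and no use of `e`, in the trivial case.) -/
def IsCostDirection (e : Fin J → ℝ) : Prop :=
  N.Nontrivial → N.K *ᵥ e = 0 ∧ (∀ w ∈ N.costKer, w ⬝ᵥ e = 0) ∧ e ⬝ᵥ e = 1 ∧ N.hβ ⬝ᵥ e < 0

/-- Resources used by at least one job type `j` with `z j = 0`. Vectors `z ∈ {0,1}^J` are
represented by `Fin J → Bool`, with `true` for the entry `1`. -/
def active (z : Fin J → Bool) : Set (Fin I) := {i | ∃ j, N.K i j = 1 ∧ z j = false}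

/-- The configurations `z` for which the cost can be reduced at constant workload; this set is
empty in the trivial case. -/
def reducible (e : Fin J → ℝ) : Set (Fin J → Bool) :=
  {z | N.Nontrivial ∧ ∃ w, N.K *ᵥ w = 0 ∧ (∀ j, z j = true → 0 ≤ w j) ∧ 0 < w ⬝ᵥ e}

end Network

/-- The parameters of the threshold policy. `vc z` is only used for reducible `z`. -/
structure Policy (J : ℕ) where
  κ : ℝ
  c₁ : ℝ
  c₂ : ℝ
  e : Fin J → ℝ
  vc : (Fin J → Bool) → Fin J → ℝ
  vb : (Fin J → Bool) → Fin J → ℝ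

namespace Policy

variable {I J : ℕ} (p : Policy J) (N : Network I J)

/-- The largest value of `(h β) · vc z` over reducible `z` (a negative number, if there
is a reducible `z`). -/
def lamTilde : ℝ := sSup ((fun z => N.hβ ⬝ᵥ p.vc z) '' N.reducible p.e)

/-- Admissible choices of the policy parameters. The norm `‖·‖` is the maximum norm; the bounds
on `vb` in this norm are weaker requirements than the same bounds in the 1-norm or the
Euclidean norm. The second bound is void if no `z` is reducible. -/
structure IsValid : Prop where
  κ_pos : 0 < p.κ
  κ_lt : p.κ < 1 / 4
  c_lt : p.c₁ < p.c₂
  dir : N.IsCostDirection p.e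
  vc_ker : ∀ z ∈ N.reducible p.e, N.K *ᵥ p.vc z = 0
  vc_nonneg : ∀ z ∈ N.reducible p.e, ∀ j, z j = true → 0 ≤ p.vc z j
  vc_dir : ∀ z ∈ N.reducible p.e, 0 < p.vc z ⬝ᵥ p.e
  vc_lt : ∀ z ∈ N.reducible p.e, ∀ j, N.ρmin / 2 < N.ρ j - p.vc z j
  vb_le : ∀ z, ‖p.vb z‖ ≤ N.ρmin / 4
  vb_le_cost : (N.reducible p.e).Nonempty →
    ∀ z, ‖p.vb z‖ ≤ |p.lamTilde N| / (4 * ‖N.β‖ * ‖N.h‖)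
  vb_active : ∀ z, ∀ i ∈ N.active z, (N.K *ᵥ p.vb z) i = 0
  vb_pos : ∀ z j, z j = true → 0 < p.vb z j

/-- The lower threshold `c̃₁ r^κ`. -/
def lower (r : ℕ) : ℝ := N.βmin * p.c₁ * (r : ℝ) ^ p.κ

/-- The upper threshold `c̃₂ r^κ`. -/
def upper (r : ℕ) : ℝ := N.βmin * p.c₂ * (r : ℝ) ^ p.κ

end Policy

/-- The state space of the scaled process in the `r`-th system: queue lengths in `r⁻¹ ℕ₀`,
scaled residual arrival and service times in `[0,∞)`, and the indicators of the job types
whose processing is stopped. -/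
structure State (J r : ℕ) where
  q : Fin J → ℝ
  ΥA : Fin J → ℝ
  ΥS : Fin J → ℝ
  E : Fin J → Bool
  q_mem : ∀ j, ∃ n : ℕ, q j = n / r
  ΥA_nonneg : ∀ j, 0 ≤ ΥA j
  ΥS_nonneg : ∀ j, 0 ≤ ΥS j

/-- The renewal counting function `s ↦ max {n ≥ 0 : x 0 + ⋯ + x (n-1) ≤ s}`. -/
def renewalCount (x : ℕ → ℝ) (s : ℝ) : ℕ := sSup {n : ℕ | ∑ l ∈ Finset.range n, x l ≤ s}

/-- Number of renewals in `[0,s]` when the first one occurs at time `R` (if `R > 0`) and the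
interrenewal times after `R` are `x 0, x 1, …`:
`renewalCount x ((s - R)⁺) + 1_{s ≥ R > 0}`. -/
def delayedCount (x : ℕ → ℝ) (R s : ℝ) : ℕ :=
  open Classical in renewalCount x (max (s - R) 0) + if R ≤ s ∧ 0 < R then 1 else 0

/-- `inf {t ≥ max σ 0 : q t ∈ S}`, with `inf ∅ = ∞`. -/
def hitTime (q : ℝ → ℝ) (S : Set ℝ) (σ : EReal) : EReal :=
  ⨅ t ∈ {t : ℝ | 0 ≤ t ∧ σ ≤ (t : EReal) ∧ q t ∈ S}, (t : EReal)

/-- The times `τ̃₁, τ̃₃, τ̃₅, …` at which the processing of a job type with queue length path `q`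
is stopped. If `e = false`, then `τ̃₁` is the first time `q` is below `a`. If `e = true`, then
the processing is already stopped at time zero, that is `τ̃₁ = 0`. -/
def stopTime (q : ℝ → ℝ) (a b : ℝ) (e : Bool) : ℕ → EReal
  | 0 => if e then 0 else hitTime q (Set.Iio a) 0
  | l + 1 => hitTime q (Set.Iio a) (hitTime q (Set.Ici b) (stopTime q a b e l))

/-- The times `τ̃₂, τ̃₄, τ̃₆, …` at which the processing is resumed. -/
def resumeTime (q : ℝ → ℝ) (a b : ℝ) (e : Bool) (l : ℕ) : EReal :=
  hitTime q (Set.Ici b) (stopTime q a b e l)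

/-- The set of times `t` with `ℰ(t) = 1`, the union of the intervals `[τ̃_{2l-1}, τ̃_{2l})`. -/
def stoppedSet (q : ℝ → ℝ) (a b : ℝ) (e : Bool) : Set ℝ :=
  ⋃ l : ℕ, {t : ℝ | stopTime q a b e l ≤ (t : EReal) ∧ (t : EReal) < resumeTime q a b e l}

section Path

variable {I J : ℕ} (N : Network I J) (p : Policy J) (r : ℕ) (y : State J r)

/-- The times at which the processing of type `j` is stopped under the policy, for the
queue length path `Q` and the initial state `y`. -/
def stopped (Q : ℝ → Fin J → ℝ) (j : Fin J) : Set ℝ :=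
  stoppedSet (fun t => Q t j) (p.lower N r) (p.upper N r) (y.E j)

/-- The configuration `𝒵(t)`: which queues are below the upper threshold. -/
def nearEmpty (Q : ℝ → Fin J → ℝ) (t : ℝ) : Fin J → Bool :=
  open Classical in fun j => decide (Q t j < p.upper N r)

/-- The allocation rate `𝔟_j(t)` of the policy. -/
def allocRate (Q : ℝ → Fin J → ℝ) (t : ℝ) (j : Fin J) : ℝ :=
  open Classical in
  if t ∈ stopped N p r y Q j then 0
  else N.ρ j
    - (if nearEmpty N p r Q t ∈ N.reducible p.e then p.vc (nearEmpty N p r Q t) j else 0)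
    - p.vb (nearEmpty N p r Q t) j

/-- `(Q, B)` are the paths of the (unscaled) queue lengths and of the cumulative allocation in
the `r`-th system under the policy, started from `y`, for the interarrival times `u` and job
sizes `v`. The unscaled initial queue length and residual times are `r` times those of `y`. -/
structure IsPolicyPath (u v : Fin J → ℕ → ℝ) (Q B : ℝ → Fin J → ℝ) : Prop where
  queue : ∀ t, 0 ≤ t → ∀ j, Q t j = r * y.q j
    + delayedCount (u j) (r * y.ΥA j) t - delayedCount (v j) (r * y.ΥS j) (B t j)
  integrable : ∀ t, 0 ≤ t → ∀ j,
    IntervalIntegrable (fun s => allocRate N p r y Q s j) volume 0 t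
  alloc : ∀ t, 0 ≤ t → ∀ j, B t j = ∫ s in (0 : ℝ)..t, allocRate N p r y Q s j

end Path

end RSN

end

/-!
A job type is stopped when its queue falls below the lower threshold, and resumed when the queue
reaches the upper one. The proof bounds the number of stops and their lengths for one type `j`, for
every realization of the input, by a single functional of the input, and then estimates the
exponential moments of this functional. It needs neither stopping times nor conditioning on the
other types, whose only influence on type `j` is through the allocation rates.

The functional is `blockGain ξ x n`, the maximum of `∑_B (∑_{l ∈ B} ξ l - x)` over families of
disjoint blocks `B` of consecutive indices below `n`. If the `ξ l` are independent with
`E exp (θ ξ) ≤ 1`, then `E exp (θ · blockGain)` is at most `(1 + η) ^ (n + 1)`, where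
`η ^ 2 = exp (-θ x)` (`lintegral_exp_blockGain_le`). With `x` a multiple of `log r` one has
`η = r ^ (-2)`, so for `n` of order `r ^ 2 T` this moment is `exp (O(T))`. It is applied to
`ξ = u - cU`, `cV - v` and `c' - u`, where `cU > 1 / α`, `cV < 1 / β` and `c' < 1 / α`; uniform
exponential moments give a common `θ` (`exists_eventually_lintegral_exp_le_one`). The third choice,
and the second, also bound the number of renewals up to the time horizon.

The policy enters as follows. Below the upper threshold the allocation rate of `j` is at most some
`w < ρ_j` (`exists_configRate_le`). Hence, when the queue falls from the upper to the lower
threshold, a block of interarrival times is long or a block of job sizes is short, and the weighted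
gains increase by an amount of order `r ^ κ` (`gain_of_crossing`). During a stop only
`O(r ^ κ)` jobs arrive, so a stop has length `O(r ^ κ)` up to the gain of its block of interarrival
times (`sub_le_gain`). Blocks of different crossings, and of different stops from the third one on,
are disjoint. Thus, if all gains are below `b = ε' T r ^ (7 κ / 4)`, there are `O(b / r ^ κ)` stops
and the total stopped time after the residual arrival time is `O(b + r ^ κ)`
(`volume_stoppedSet_le`). The exceptional event has probability at most `3 exp (O(T) - θ b)`.
-/

/-! ### Gains of disjoint blocks -/

namespace RSN

/-- The pair `(blockGain ξ x n, openGain ξ x n)`, defined by dynamic programming.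
For a cost `x ≥ 0`, the first entry is the largest value of `∑_B (∑_{l ∈ B} ξ l - x)` over the
finite families of disjoint blocks `B` of consecutive indices below `n`; the second is the same
maximum over the families with one more block, possibly empty, which ends at `n` and is still
open. -/
noncomputable def gainPair (ξ : ℕ → ℝ) (x : ℝ) : ℕ → ℝ × ℝ
  | 0 => (0, -x)
  | n + 1 =>
    (max (gainPair ξ x n).1 ((gainPair ξ x n).2 + ξ n),
      max ((gainPair ξ x n).2 + ξ n) ((gainPair ξ x n).1 - x))

/-- The maximal total gain of disjoint blocks of indices below `n`, where a block `B` has the gain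
`∑_{l ∈ B} ξ l - x`. -/
noncomputable def blockGain (ξ : ℕ → ℝ) (x : ℝ) (n : ℕ) : ℝ := (gainPair ξ x n).1

/-- The maximal total gain of disjoint blocks, the last of which is still open at `n`. -/
noncomputable def openGain (ξ : ℕ → ℝ) (x : ℝ) (n : ℕ) : ℝ := (gainPair ξ x n).2

section Gain

variable (ξ : ℕ → ℝ) (x : ℝ)

@[simp] lemma blockGain_zero : blockGain ξ x 0 = 0 := rfl

@[simp] lemma openGain_zero : openGain ξ x 0 = -x := rfl

lemma blockGain_succ (n : ℕ) :
    blockGain ξ x (n + 1) = max (blockGain ξ x n) (openGain ξ x n + ξ n) := rfl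

lemma openGain_succ (n : ℕ) :
    openGain ξ x (n + 1) = max (openGain ξ x n + ξ n) (blockGain ξ x n - x) := rfl

lemma blockGain_mono : Monotone (blockGain ξ x) :=
  monotone_nat_of_le_succ fun n => by rw [blockGain_succ]; exact le_max_left _ _

lemma blockGain_nonneg (n : ℕ) : 0 ≤ blockGain ξ x n :=
  blockGain_mono ξ x (Nat.zero_le n)

variable {x}

lemma blockGain_sub_le_openGain (hx : 0 ≤ x) (n : ℕ) : blockGain ξ x n - x ≤ openGain ξ x n := by
  cases n with
  | zero => simp
  | succ n =>
    rw [blockGain_succ, openGain_succ]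
    rcases le_total (blockGain ξ x n) (openGain ξ x n + ξ n) with h | h
    · rw [max_eq_right h]; exact (by linarith : _ ≤ openGain ξ x n + ξ n).trans (le_max_left _ _)
    · rw [max_eq_left h]; exact le_max_right _ _

/-- A further block `[m, n)` raises the maximal gain by at least its own gain. -/
lemma blockGain_add_le (hx : 0 ≤ x) {m n : ℕ} (hmn : m ≤ n) :
    blockGain ξ x m + (∑ l ∈ Finset.Ico m n, ξ l - x) ≤ blockGain ξ x n := by
  have key : ∀ k, m ≤ k →
      blockGain ξ x m - x + ∑ l ∈ Finset.Ico m k, ξ l ≤ openGain ξ x k := by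
    intro k hk
    induction k, hk using Nat.le_induction with
    | base => simpa using blockGain_sub_le_openGain ξ hx m
    | succ k hk ih =>
      rw [Finset.sum_Ico_succ_top hk, openGain_succ]
      exact (by linarith : _ ≤ openGain ξ x k + ξ k).trans (le_max_left _ _)
  rcases hmn.eq_or_lt with rfl | h
  · simp; linarith
  · obtain ⟨k, rfl⟩ : ∃ k, n = k + 1 := ⟨n - 1, by omega⟩
    have hk : m ≤ k := by omega
    rw [Finset.sum_Ico_succ_top hk, blockGain_succ]
    have := key k hk
    exact (by linarith : _ ≤ openGain ξ x k + ξ k).trans (le_max_right _ _)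

lemma gainPair_congr {ξ ξ' : ℕ → ℝ} (x : ℝ) {n : ℕ} (h : ∀ l < n, ξ l = ξ' l) :
    gainPair ξ x n = gainPair ξ' x n := by
  induction n with
  | zero => rfl
  | succ n ih =>
    simp only [gainPair]
    rw [ih fun l hl => h l (by omega), h n (by omega)]

end Gain

section GainMoments

variable {Ω : Type*} [MeasurableSpace Ω]

lemma measurable_gainPair {ξ : ℕ → Ω → ℝ} (hξ : ∀ l, Measurable (ξ l)) (x : ℝ) (n : ℕ) :
    Measurable fun ω => gainPair (fun l => ξ l ω) x n := by
  induction n with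
  | zero => exact measurable_const
  | succ n ih =>
    simp only [gainPair]
    have h1 := ih.fst
    have h2 := ih.snd
    exact (h1.max (h2.add (hξ n))).prodMk ((h2.add (hξ n)).max (h1.sub_const x))

/-- The gains up to `n` depend on `ξ 0, …, ξ (n - 1)` only. -/
lemma indepFun_gainPair {P : Measure Ω} {ξ : ℕ → Ω → ℝ} (hξ : ∀ l, Measurable (ξ l))
    (hind : iIndepFun ξ P) (x : ℝ) (n : ℕ) :
    IndepFun (fun ω => gainPair (fun l => ξ l ω) x n) (ξ n) P := by
  have h := hind.indepFun_finset (Finset.range n) {n} (by simp) hξ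
  let φ : (Finset.range n → ℝ) → ℝ × ℝ := fun z =>
    gainPair (fun l => if hl : l ∈ Finset.range n then z ⟨l, hl⟩ else 0) x n
  have hφ : Measurable φ := by
    refine measurable_gainPair (fun l => ?_) x n
    by_cases hl : l ∈ Finset.range n
    · simp only [hl, dite_true]; exact measurable_pi_apply _
    · simp only [hl, dite_false]; exact measurable_const
  have h' := h.comp hφ (measurable_pi_apply (⟨n, by simp⟩ : ({n} : Finset ℕ)))
  convert h' using 1
  · funext ω
    refine gainPair_congr x fun l hl => ?_
    simp [hl]
  · rfl

/-- If the terms are independent with `E exp (θ ξ) ≤ 1` and the cost `x` of a block satisfies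
`exp (-θ x) = η²`, then `E exp (θ · gain)` grows by the factor `1 + η` per step at most. -/
theorem lintegral_exp_blockGain_le {P : Measure Ω} [IsProbabilityMeasure P] {ξ : ℕ → Ω → ℝ}
    (hξ : ∀ l, Measurable (ξ l)) (hind : iIndepFun ξ P) {θ x η : ℝ} (hη : 0 < η)
    (hx : Real.exp (-(θ * x)) = η ^ 2)
    (hmgf : ∀ l, ∫⁻ ω, ENNReal.ofReal (Real.exp (θ * ξ l ω)) ∂P ≤ 1) (n : ℕ) :
    ∫⁻ ω, ENNReal.ofReal (Real.exp (θ * blockGain (fun l => ξ l ω) x n)) ∂P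
      ≤ ENNReal.ofReal ((1 + η) ^ (n + 1)) := by
  set o : ℕ → ℝ≥0∞ := fun n =>
    ∫⁻ ω, ENNReal.ofReal (Real.exp (θ * blockGain (fun l => ξ l ω) x n)) ∂P with ho
  set j : ℕ → ℝ≥0∞ := fun n =>
    ∫⁻ ω, ENNReal.ofReal (Real.exp (θ * openGain (fun l => ξ l ω) x n)) ∂P with hj
  have hmO : ∀ n, Measurable fun ω =>
      ENNReal.ofReal (Real.exp (θ * blockGain (fun l => ξ l ω) x n)) := fun n =>
    ((measurable_gainPair hξ x n).fst.const_mul θ).exp.ennreal_ofReal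
  have hmJ : ∀ n, Measurable fun ω =>
      ENNReal.ofReal (Real.exp (θ * openGain (fun l => ξ l ω) x n)) := fun n =>
    ((measurable_gainPair hξ x n).snd.const_mul θ).exp.ennreal_ofReal
  have hmξ : ∀ n, Measurable fun ω => ENNReal.ofReal (Real.exp (θ * ξ n ω)) := fun n =>
    ((hξ n).const_mul θ).exp.ennreal_ofReal
  have hstep : ∀ n, ∫⁻ ω, ENNReal.ofReal (Real.exp (θ * openGain (fun l => ξ l ω) x n)) *
      ENNReal.ofReal (Real.exp (θ * ξ n ω)) ∂P ≤ j n := by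
    intro n
    have hi : IndepFun (fun ω => ENNReal.ofReal (Real.exp (θ * openGain (fun l => ξ l ω) x n)))
        (fun ω => ENNReal.ofReal (Real.exp (θ * ξ n ω))) P :=
      (indepFun_gainPair hξ hind x n).comp
        (φ := fun g : ℝ × ℝ => ENNReal.ofReal (Real.exp (θ * g.2)))
        (ψ := fun z : ℝ => ENNReal.ofReal (Real.exp (θ * z)))
        (measurable_snd.const_mul θ).exp.ennreal_ofReal
        (measurable_id.const_mul θ).exp.ennreal_ofReal
    rw [lintegral_mul_eq_lintegral_mul_lintegral_of_indepFun'' (hmJ n).aemeasurable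
      (hmξ n).aemeasurable hi]
    exact (mul_le_mul_right (hmgf n) _).trans (by rw [mul_one])
  -- the exponential of a maximum is at most the sum of the exponentials
  have hexp : ∀ a b : ℝ, ENNReal.ofReal (Real.exp (θ * max a b)) ≤
      ENNReal.ofReal (Real.exp (θ * a)) + ENNReal.ofReal (Real.exp (θ * b)) := by
    intro a b
    rcases le_total a b with h | h
    · rw [max_eq_right h]; exact le_add_self
    · rw [max_eq_left h]; exact le_self_add
  have hO : ∀ n, o (n + 1) ≤ o n + j n := by
    intro n
    calc o (n + 1) ≤ ∫⁻ ω, (ENNReal.ofReal (Real.exp (θ * blockGain (fun l => ξ l ω) x n)) +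
          ENNReal.ofReal (Real.exp (θ * openGain (fun l => ξ l ω) x n)) *
            ENNReal.ofReal (Real.exp (θ * ξ n ω))) ∂P := by
          refine lintegral_mono fun ω => ?_
          rw [blockGain_succ, ← ENNReal.ofReal_mul (Real.exp_nonneg _), ← Real.exp_add, ← mul_add]
          exact hexp _ _
      _ = o n + _ := lintegral_add_left (hmO n) _
      _ ≤ o n + j n := by gcongr; exact hstep n
  have hJ : ∀ n, j (n + 1) ≤ j n + ENNReal.ofReal (η ^ 2) * o n := by
    intro n
    calc j (n + 1) ≤ ∫⁻ ω, (ENNReal.ofReal (Real.exp (θ * openGain (fun l => ξ l ω) x n)) *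
            ENNReal.ofReal (Real.exp (θ * ξ n ω)) + ENNReal.ofReal (η ^ 2) *
            ENNReal.ofReal (Real.exp (θ * blockGain (fun l => ξ l ω) x n))) ∂P := by
          refine lintegral_mono fun ω => ?_
          rw [openGain_succ, ← ENNReal.ofReal_mul (Real.exp_nonneg _), ← Real.exp_add, ← mul_add,
            ← hx, ← ENNReal.ofReal_mul (Real.exp_nonneg _), ← Real.exp_add]
          refine (hexp _ _).trans (le_of_eq ?_)
          congr 3
          ring
      _ = _ + ∫⁻ ω, ENNReal.ofReal (η ^ 2) *
            ENNReal.ofReal (Real.exp (θ * blockGain (fun l => ξ l ω) x n)) ∂P :=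
          lintegral_add_right _ ((hmO n).const_mul _)
      _ ≤ j n + ENNReal.ofReal (η ^ 2) * o n := by
          rw [lintegral_const_mul _ (hmO n)]
          gcongr
          exact hstep n
  have hcancel : ENNReal.ofReal η * ENNReal.ofReal η⁻¹ = 1 := by
    rw [← ENNReal.ofReal_mul hη.le, mul_inv_cancel₀ hη.ne', ENNReal.ofReal_one]
  have hsq : ENNReal.ofReal η⁻¹ * ENNReal.ofReal (η ^ 2) = ENNReal.ofReal η := by
    rw [← ENNReal.ofReal_mul (by positivity)]
    congr 1
    field_simp
  have main : ∀ n, o n + ENNReal.ofReal η⁻¹ * j n ≤ (1 + ENNReal.ofReal η) ^ (n + 1) := by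
    intro n
    induction n with
    | zero =>
      have h0 : o 0 = 1 := by simp [ho]
      have h1 : j 0 = ENNReal.ofReal (η ^ 2) := by
        simp only [hj, openGain_zero, mul_neg, hx]
        simp
      rw [h0, h1, hsq, zero_add, pow_one]
    | succ n ih =>
      calc o (n + 1) + ENNReal.ofReal η⁻¹ * j (n + 1)
          ≤ (o n + j n) + ENNReal.ofReal η⁻¹ * (j n + ENNReal.ofReal (η ^ 2) * o n) := by
            gcongr
            · exact hO n
            · exact hJ n
        _ = (o n + j n) + (ENNReal.ofReal η⁻¹ * j n
              + (ENNReal.ofReal η⁻¹ * ENNReal.ofReal (η ^ 2)) * o n) := by ring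
        _ = (o n + (ENNReal.ofReal η * ENNReal.ofReal η⁻¹) * j n) + (ENNReal.ofReal η⁻¹ * j n
              + ENNReal.ofReal η * o n) := by rw [hsq, hcancel, one_mul]
        _ = (1 + ENNReal.ofReal η) * (o n + ENNReal.ofReal η⁻¹ * j n) := by ring
        _ ≤ (1 + ENNReal.ofReal η) * (1 + ENNReal.ofReal η) ^ (n + 1) := by gcongr
        _ = (1 + ENNReal.ofReal η) ^ (n + 1 + 1) := by ring
  calc o n ≤ o n + ENNReal.ofReal η⁻¹ * j n := le_self_add
    _ ≤ (1 + ENNReal.ofReal η) ^ (n + 1) := main n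
    _ = ENNReal.ofReal ((1 + η) ^ (n + 1)) := by
      rw [← ENNReal.ofReal_one, ← ENNReal.ofReal_add zero_le_one hη.le,
        ENNReal.ofReal_pow (by linarith)]

/-- The resulting tail bound for the maximal gain, by Markov's inequality. -/
theorem measure_le_blockGain_le {P : Measure Ω} [IsProbabilityMeasure P] {ξ : ℕ → Ω → ℝ}
    (hξ : ∀ l, Measurable (ξ l)) (hind : iIndepFun ξ P) {θ x η : ℝ} (hη : 0 < η)
    (hx : Real.exp (-(θ * x)) = η ^ 2) (hθ : 0 ≤ θ)
    (hmgf : ∀ l, ∫⁻ ω, ENNReal.ofReal (Real.exp (θ * ξ l ω)) ∂P ≤ 1) (n : ℕ) (y : ℝ) :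
    P {ω | y ≤ blockGain (fun l => ξ l ω) x n}
      ≤ ENNReal.ofReal (Real.exp (η * (n + 1) - θ * y)) := by
  have hm : Measurable fun ω =>
      ENNReal.ofReal (Real.exp (θ * blockGain (fun l => ξ l ω) x n)) :=
    ((measurable_gainPair hξ x n).fst.const_mul θ).exp.ennreal_ofReal
  have h0 : ENNReal.ofReal (Real.exp (θ * y)) ≠ 0 := by
    simpa using Real.exp_pos _
  calc P {ω | y ≤ blockGain (fun l => ξ l ω) x n}
      ≤ P {ω | ENNReal.ofReal (Real.exp (θ * y)) ≤
          ENNReal.ofReal (Real.exp (θ * blockGain (fun l => ξ l ω) x n))} := by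
        refine measure_mono fun ω hω => ?_
        simp only [Set.mem_ofPred_eq] at hω ⊢
        gcongr
    _ ≤ (∫⁻ ω, ENNReal.ofReal (Real.exp (θ * blockGain (fun l => ξ l ω) x n)) ∂P) /
          ENNReal.ofReal (Real.exp (θ * y)) :=
        meas_ge_le_lintegral_div hm.aemeasurable h0 ENNReal.ofReal_ne_top
    _ ≤ ENNReal.ofReal ((1 + η) ^ (n + 1)) / ENNReal.ofReal (Real.exp (θ * y)) := by
        gcongr
        exact lintegral_exp_blockGain_le hξ hind hη hx hmgf n
    _ ≤ ENNReal.ofReal (Real.exp (η * (n + 1))) / ENNReal.ofReal (Real.exp (θ * y)) := by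
        gcongr
        calc (1 + η) ^ (n + 1) ≤ Real.exp η ^ (n + 1) := by
              gcongr; linarith [Real.add_one_le_exp η]
          _ = Real.exp (η * (n + 1)) := by
              rw [← Real.exp_nat_mul]; push_cast; ring_nf
    _ = ENNReal.ofReal (Real.exp (η * (n + 1) - θ * y)) := by
        rw [← ENNReal.ofReal_div_of_pos (Real.exp_pos _), Real.exp_sub]

end GainMoments

/-! ### Exponential moments of variables with negative mean -/

lemma exp_le_one_add_add_sq_mul_exp_abs (z : ℝ) :
    Real.exp z ≤ 1 + z + z ^ 2 * Real.exp |z| := by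
  have h := Complex.norm_exp_sub_sum_le_norm_mul_exp (z : ℂ) 2
  have h' : Complex.exp z - ∑ m ∈ Finset.range 2, (z : ℂ) ^ m / (m.factorial : ℂ) =
      ((Real.exp z - (1 + z) : ℝ) : ℂ) := by
    simp [Finset.sum_range_succ]
  rw [h', Complex.norm_real, Complex.norm_real, Real.norm_eq_abs, Real.norm_eq_abs, sq_abs] at h
  linarith [(abs_le.1 h).2]

/-- Variables with mean at most `-γ < 0` and uniformly bounded exponential moments satisfy
`E exp (θ X) ≤ 1` for all small `θ`, uniformly. -/
theorem exists_lintegral_exp_le_one {Ω : Type*} [MeasurableSpace Ω] (P : Measure Ω)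
    [IsProbabilityMeasure P] {δ c γ M : ℝ} (hδ : 0 < δ) (hγ : 0 < γ) (hM : 0 ≤ M) :
    ∃ θ₀ : ℝ, 0 < θ₀ ∧ ∀ θ, 0 < θ → θ ≤ θ₀ → ∀ X W : Ω → ℝ, Integrable X P → Measurable W →
      (∀ᵐ ω ∂P, |X ω| ≤ W ω + c) →
      ∫⁻ ω, ENNReal.ofReal (Real.exp (δ * W ω)) ∂P ≤ ENNReal.ofReal M →
      ∫ ω, X ω ∂P ≤ -γ → ∫⁻ ω, ENNReal.ofReal (Real.exp (θ * X ω)) ∂P ≤ 1 := by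
  set L : ℝ := 8 / δ ^ 2 * Real.exp (δ * c) with hL
  have hLpos : 0 < L := by positivity
  refine ⟨min (δ / 2) (γ / (L * M + 1)), by positivity, ?_⟩
  intro θ hθ hθ₀ X W hX hW hXW hWM hmean
  have hθ1 : θ ≤ δ / 2 := hθ₀.trans (min_le_left _ _)
  have hθ2 : θ * (L * M + 1) ≤ γ := by
    have := hθ₀.trans (min_le_right _ _)
    rwa [le_div_iff₀ (by positivity)] at this
  have hint : Integrable (fun ω => Real.exp (δ * W ω)) P := by
    refine ⟨(hW.const_mul δ).exp.aestronglyMeasurable, ?_⟩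
    rw [hasFiniteIntegral_iff_ofReal (ae_of_all _ fun ω => (Real.exp_pos _).le)]
    exact hWM.trans_lt ENNReal.ofReal_lt_top
  have hintM : ∫ ω, Real.exp (δ * W ω) ∂P ≤ M := by
    rw [integral_eq_lintegral_of_nonneg_ae (ae_of_all _ fun ω => (Real.exp_pos _).le)
      (hW.const_mul δ).exp.aestronglyMeasurable]
    exact ENNReal.toReal_le_of_le_ofReal hM hWM
  have hbound : ∀ᵐ ω ∂P, Real.exp (θ * X ω) ≤
      1 + θ * X ω + θ ^ 2 * L * Real.exp (δ * W ω) := by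
    filter_upwards [hXW] with ω hω
    have h1 := exp_le_one_add_add_sq_mul_exp_abs (θ * X ω)
    have h2 : (δ / 2 * |X ω|) ^ 2 / 2 ≤ Real.exp (δ / 2 * |X ω|) := by
      have hz : 0 ≤ δ / 2 * |X ω| := by positivity
      linarith [Real.quadratic_le_exp_of_nonneg hz]
    have h3 : X ω ^ 2 ≤ 8 / δ ^ 2 * Real.exp (δ / 2 * |X ω|) := by
      have : X ω ^ 2 = 8 / δ ^ 2 * ((δ / 2 * |X ω|) ^ 2 / 2) := by
        rw [mul_pow, sq_abs]; field_simp; norm_num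
      rw [this]; gcongr
    have h4 : Real.exp |θ * X ω| ≤ Real.exp (δ / 2 * |X ω|) := by
      rw [abs_mul, abs_of_pos hθ]; gcongr
    have h5 : (θ * X ω) ^ 2 * Real.exp |θ * X ω| ≤ θ ^ 2 * L * Real.exp (δ * W ω) := by
      calc (θ * X ω) ^ 2 * Real.exp |θ * X ω|
          ≤ (θ ^ 2 * (8 / δ ^ 2 * Real.exp (δ / 2 * |X ω|))) * Real.exp (δ / 2 * |X ω|) := by
            rw [mul_pow]; gcongr
        _ = θ ^ 2 * (8 / δ ^ 2) * Real.exp (δ * |X ω|) := by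
            rw [show δ * |X ω| = δ / 2 * |X ω| + δ / 2 * |X ω| by ring, Real.exp_add]; ring
        _ ≤ θ ^ 2 * (8 / δ ^ 2) * Real.exp (δ * (W ω + c)) := by gcongr
        _ = θ ^ 2 * L * Real.exp (δ * W ω) := by
            rw [mul_add, Real.exp_add, hL]; ring
    linarith
  calc ∫⁻ ω, ENNReal.ofReal (Real.exp (θ * X ω)) ∂P
      ≤ ∫⁻ ω, ENNReal.ofReal (1 + θ * X ω + θ ^ 2 * L * Real.exp (δ * W ω)) ∂P := by
        refine lintegral_mono_ae ?_
        filter_upwards [hbound] with ω hω using ENNReal.ofReal_le_ofReal hω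
    _ = ENNReal.ofReal (∫ ω, (1 + θ * X ω + θ ^ 2 * L * Real.exp (δ * W ω)) ∂P) := by
        rw [ofReal_integral_eq_lintegral_ofReal]
        · exact ((integrable_const _).add (hX.const_mul θ)).add (hint.const_mul _)
        · filter_upwards [hbound] with ω hω using (Real.exp_pos _).le.trans hω
    _ ≤ ENNReal.ofReal 1 := by
        apply ENNReal.ofReal_le_ofReal
        have hi : Integrable (fun ω => 1 + θ * X ω) P :=
          (integrable_const _).add (hX.const_mul θ)
        rw [integral_add hi (hint.const_mul _),
          integral_add (integrable_const _) (hX.const_mul θ), integral_const_mul,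
          integral_const_mul]
        simp only [integral_const, probReal_univ, smul_eq_mul, mul_one]
        have h1 : θ * ∫ ω, X ω ∂P ≤ θ * (-γ) := by gcongr
        have h2 : θ ^ 2 * L * ∫ ω, Real.exp (δ * W ω) ∂P ≤ θ ^ 2 * L * M := by gcongr
        nlinarith
    _ = 1 := ENNReal.ofReal_one

/-! ### Delayed renewal counts -/

/-- The number of interrenewal times `x 0, x 1, …` that have begun by time `t`, when `x 0` begins
at time `R`. In contrast to `delayedCount`, it treats the cases `R = 0` and `0 < R` alike; the two
counts differ by a constant in `t`. -/
noncomputable def startedCount (x : ℕ → ℝ) (R t : ℝ) : ℕ :=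
  if t < R then 0 else renewalCount x (t - R) + 1

section Count

variable {x : ℕ → ℝ} {R : ℝ}

lemma sum_range_mono_of_pos (hx : ∀ l, 0 < x l) :
    StrictMono fun n => ∑ l ∈ Finset.range n, x l :=
  strictMono_nat_of_lt_succ fun n => by
    rw [Finset.sum_range_succ]; linarith [hx n]

lemma delayedCount_eq_startedCount_sub (hx : ∀ l, 0 < x l) (hR : 0 ≤ R) (t : ℝ) (ht : 0 ≤ t) :
    (delayedCount x R t : ℝ) = startedCount x R t - if R = 0 then 1 else 0 := by
  unfold delayedCount startedCount
  rcases lt_or_ge t R with h | h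
  · have hR0 : R ≠ 0 := by linarith
    have h0 : renewalCount x 0 = 0 := by
      have : {n : ℕ | ∑ l ∈ Finset.range n, x l ≤ 0} = {0} := by
        ext n
        simp only [Set.mem_ofPred_eq, Set.mem_singleton_iff]
        constructor
        · intro hn
          by_contra hne
          have := sum_range_mono_of_pos hx (Nat.pos_of_ne_zero hne)
          simp only [Finset.range_zero, Finset.sum_empty] at this
          linarith
        · rintro rfl; simp
      simp [renewalCount, this]
    rw [max_eq_right (by linarith), h0]
    simp [h, hR0, not_le.2 h]
  · rw [max_eq_left (by linarith)]
    rcases hR.eq_or_lt with rfl | hpos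
    · simp [not_lt.2 h]
    · simp [not_lt.2 h, h, hpos, hpos.ne']

/-- The `k`-th interrenewal time has begun by time `t` iff the start, and the preceding
interrenewal times, are over by then. -/
lemma lt_startedCount_iff (hx : ∀ l, 0 < x l) {n : ℕ} {t : ℝ}
    (hR : 0 ≤ R) (ht : t < ∑ l ∈ Finset.range n, x l) (k : ℕ) :
    k < startedCount x R t ↔ R + ∑ l ∈ Finset.range k, x l ≤ t := by
  have hmono := (sum_range_mono_of_pos hx)
  unfold startedCount
  rcases lt_or_ge t R with h | h
  · simp only [h, if_true, Nat.not_lt_zero, false_iff, not_le]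
    linarith [Finset.sum_nonneg fun l (_ : l ∈ Finset.range k) => (hx l).le]
  · simp only [not_lt.2 h, if_false, Nat.lt_succ_iff]
    have hne : {n : ℕ | ∑ l ∈ Finset.range n, x l ≤ t - R}.Nonempty := ⟨0, by simpa using h⟩
    have hbdd : BddAbove {n : ℕ | ∑ l ∈ Finset.range n, x l ≤ t - R} := by
      refine ⟨n, fun m hm => ?_⟩
      by_contra hmn
      have h1 := hmono (not_le.1 hmn)
      simp only [Set.mem_ofPred_eq] at hm h1
      linarith
    constructor
    · intro hk
      have h1 := Nat.sSup_mem hne hbdd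
      have h2 := hmono.monotone hk
      simp only [Set.mem_ofPred_eq] at h1
      simp only [renewalCount] at h2
      linarith
    · intro hk
      exact le_csSup hbdd (by simp only [Set.mem_ofPred_eq]; linarith)

variable (hx : ∀ l, 0 < x l) (hR : 0 ≤ R)

include hx hR

lemma startedCount_le {n : ℕ} {t : ℝ} (ht : t < ∑ l ∈ Finset.range n, x l) :
    startedCount x R t ≤ n := by
  by_contra h
  have := (lt_startedCount_iff hx hR ht n).1 (not_le.1 h)
  linarith

lemma startedCount_mono {n : ℕ} {s t : ℝ} (hst : s ≤ t) (ht : t < ∑ l ∈ Finset.range n, x l) :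
    startedCount x R s ≤ startedCount x R t := by
  by_contra h
  have h1 := (lt_startedCount_iff hx hR (hst.trans_lt ht) _).1 (not_le.1 h)
  exact lt_irrefl _ ((lt_startedCount_iff hx hR ht _).2 (h1.trans hst))

lemma startedCount_eventually_eq {n : ℕ} {t : ℝ} (ht : t < ∑ l ∈ Finset.range n, x l) :
    ∀ᶠ s in 𝓝[≥] t, startedCount x R s = startedCount x R t := by
  have h1 : t < R + ∑ l ∈ Finset.range (startedCount x R t), x l := by
    by_contra h
    exact lt_irrefl _ ((lt_startedCount_iff hx hR ht _).2 (not_lt.1 h))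
  filter_upwards [self_mem_nhdsWithin, nhdsWithin_le_nhds (Iio_mem_nhds h1),
    nhdsWithin_le_nhds (Iio_mem_nhds ht)] with s hs hs1 hs2
  refine le_antisymm ?_ (startedCount_mono hx hR hs hs2)
  by_contra h
  have := (lt_startedCount_iff hx hR hs2 _).1 (not_le.1 h)
  exact absurd hs1 (not_lt.2 this)

/-- The count has jumps of size one at most. -/
lemma exists_startedCount_le_add_one {n : ℕ} {t : ℝ} (ht : t < ∑ l ∈ Finset.range n, x l) :
    ∃ t₀ < t, ∀ s, t₀ ≤ s → s ≤ t → startedCount x R t ≤ startedCount x R s + 1 := by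
  rcases Nat.lt_or_ge (startedCount x R t) 2 with h | h
  · exact ⟨t - 1, by linarith, fun s _ _ => by omega⟩
  · obtain ⟨k, hk⟩ : ∃ k, startedCount x R t = k + 2 :=
      ⟨startedCount x R t - 2, by omega⟩
    have h1 := (lt_startedCount_iff hx hR ht (k + 1)).1 (by omega)
    have h2 := sum_range_mono_of_pos hx (Nat.lt_succ_self k)
    simp only [Nat.succ_eq_add_one] at h2
    refine ⟨R + ∑ l ∈ Finset.range k, x l, by linarith, fun s hs hst => ?_⟩
    have := (lt_startedCount_iff hx hR (hst.trans_lt ht) k).2 hs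
    omega

lemma one_le_startedCount_iff {n : ℕ} {t : ℝ} (ht : t < ∑ l ∈ Finset.range n, x l) :
    1 ≤ startedCount x R t ↔ R ≤ t := by
  rw [← Nat.lt_iff_add_one_le, lt_startedCount_iff hx hR ht 0]
  simp

lemma sub_le_sum_Ico_startedCount {n : ℕ} {s t : ℝ} (hst : s ≤ t)
    (ht : t < ∑ l ∈ Finset.range n, x l) (hs : 1 ≤ startedCount x R s) :
    t - s ≤ ∑ l ∈ Finset.Ico (startedCount x R s - 1) (startedCount x R t), x l := by
  have hm := startedCount_mono hx hR hst ht
  rw [Finset.sum_Ico_eq_sub _ (by omega)]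
  have h1 : t < R + ∑ l ∈ Finset.range (startedCount x R t), x l := by
    by_contra h
    exact lt_irrefl _ ((lt_startedCount_iff hx hR ht _).2 (not_lt.1 h))
  have h2 := (lt_startedCount_iff hx hR (hst.trans_lt ht) (startedCount x R s - 1)).1 (by omega)
  linarith

lemma sum_Ico_startedCount_le_sub {n : ℕ} {s t : ℝ} (hst : s ≤ t)
    (ht : t < ∑ l ∈ Finset.range n, x l) (hc : startedCount x R s + 1 ≤ startedCount x R t) :
    ∑ l ∈ Finset.Ico (startedCount x R s) (startedCount x R t - 1), x l ≤ t - s := by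
  rw [Finset.sum_Ico_eq_sub _ (by omega)]
  have h1 : s < R + ∑ l ∈ Finset.range (startedCount x R s), x l := by
    by_contra h
    exact lt_irrefl _ ((lt_startedCount_iff hx hR (hst.trans_lt ht) _).2 (not_lt.1 h))
  have h2 := (lt_startedCount_iff hx hR ht (startedCount x R t - 1)).1 (by omega)
  linarith

end Count

/-! ### Hitting times -/

section Hit

variable {q : ℝ → ℝ} {S : Set ℝ} {σ : EReal}

lemma le_hitTime : σ ≤ hitTime q S σ := le_iInf₂ fun _ ht => ht.2.1

lemma hitTime_nonneg : 0 ≤ hitTime q S σ :=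
  le_iInf₂ fun t ht => by exact_mod_cast ht.1

lemma hitTime_le {t : ℝ} (h0 : 0 ≤ t) (h1 : σ ≤ (t : EReal)) (h2 : q t ∈ S) :
    hitTime q S σ ≤ (t : EReal) := iInf₂_le t ⟨h0, h1, h2⟩

/-- The infimum is attained for paths that are constant to the right of each time. -/
lemma exists_eq_hitTime {H : ℝ} (hq : ∀ t, 0 ≤ t → t ≤ H → ∀ᶠ s in 𝓝[≥] t, q s = q t)
    (h : hitTime q S σ ≤ (H : EReal)) :
    ∃ τ : ℝ, 0 ≤ τ ∧ τ ≤ H ∧ hitTime q S σ = τ ∧ q τ ∈ S := by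
  have h0 : (0 : EReal) ≤ hitTime q S σ := hitTime_nonneg
  have hbot : hitTime q S σ ≠ ⊥ := fun hb => by simp [hb] at h0
  have htop : hitTime q S σ ≠ ⊤ := fun ht => by simp [ht] at h
  obtain ⟨τ, hτ⟩ : ∃ τ : ℝ, hitTime q S σ = τ := ⟨_, (EReal.coe_toReal htop hbot).symm⟩
  have hτ0 : 0 ≤ τ := by rw [hτ] at h0; exact_mod_cast h0
  have hτH : τ ≤ H := by rw [hτ] at h; exact_mod_cast h
  refine ⟨τ, hτ0, hτH, hτ, ?_⟩
  obtain ⟨b, hb, hbq⟩ := mem_nhdsGE_iff_exists_Ico_subset.1 (hq τ hτ0 hτH)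
  have hlt : hitTime q S σ < (b : EReal) := by rw [hτ]; exact_mod_cast hb
  obtain ⟨t, ht⟩ := iInf_lt_iff.1 hlt
  obtain ⟨ht1, ht2⟩ := iInf_lt_iff.1 ht
  have h3 : τ ≤ t := by
    have := hitTime_le ht1.1 ht1.2.1 ht1.2.2
    rw [hτ] at this; exact_mod_cast this
  have h4 : q t = q τ := hbq ⟨h3, by exact_mod_cast ht2⟩
  rw [← h4]; exact ht1.2.2

end Hit

section StopTime

variable (q : ℝ → ℝ) (a b : ℝ) (e : Bool)

lemma stopTime_nonneg (l : ℕ) : 0 ≤ stopTime q a b e l := by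
  cases l with
  | zero => unfold stopTime; split_ifs; exacts [le_rfl, hitTime_nonneg]
  | succ l => exact hitTime_nonneg

lemma stopTime_le_resumeTime (l : ℕ) : stopTime q a b e l ≤ resumeTime q a b e l := le_hitTime

lemma resumeTime_le_stopTime_succ (l : ℕ) :
    resumeTime q a b e l ≤ stopTime q a b e (l + 1) := le_hitTime

lemma stopTime_mono : Monotone (stopTime q a b e) :=
  monotone_nat_of_le_succ fun l =>
    (stopTime_le_resumeTime q a b e l).trans (resumeTime_le_stopTime_succ q a b e l)

lemma lt_of_lt_resumeTime {l : ℕ} {t : ℝ} (h1 : stopTime q a b e l ≤ (t : EReal))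
    (h2 : (t : EReal) < resumeTime q a b e l) : q t < b := by
  by_contra h
  have h0 : (0 : EReal) ≤ t := (stopTime_nonneg q a b e l).trans h1
  exact absurd (hitTime_le (by exact_mod_cast h0) h1 (not_lt.1 h)) (not_le.2 h2)

end StopTime

/-! ### Paths of a single queue -/

/-- The part after the residual arrival time `RA` and up to time `H` of the stop number `l`. -/
def stopPart (Q : ℝ → ℝ) (RA lo hi H : ℝ) (e : Bool) (l : ℕ) : Set ℝ :=
  {t : ℝ | stopTime Q lo hi e l ≤ (t : EReal) ∧ (t : EReal) < resumeTime Q lo hi e l} ∩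
    Set.Ioc RA H

lemma stopPart_eq_empty {Q : ℝ → ℝ} {RA lo hi H : ℝ} {e : Bool} {l : ℕ}
    (hl : ¬ stopTime Q lo hi e l ≤ (H : EReal)) :
    stopPart Q RA lo hi H e l = ∅ := by
  ext t
  simp only [stopPart, Set.mem_inter_iff, Set.mem_ofPred_eq, Set.mem_Ioc, Set.mem_empty_iff_false,
    iff_false, not_and]
  intro h1 _ htH
  exact hl (h1.1.trans (by exact_mod_cast htH))

/-- The properties of the path of a single queue under a threshold policy on `[0, H]` that bound
its stopped time. The queue has arrivals `u` and services `v` with residual times `RA`, `RS`, starts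
from `q`, is stopped below `lo` and resumed at `hi`. The allocation `A` has rates in `[0, W]`, which
are at most `w` while the queue is below `hi` and vanish while the queue is stopped. Fewer than `n`
interarrival times are over by time `H`, and likewise for the services. -/
structure IsThresholdPath (u v : ℕ → ℝ) (RA RS q lo hi w W H : ℝ) (e : Bool) (n : ℕ)
    (Q A : ℝ → ℝ) : Prop where
  u_pos : ∀ l, 0 < u l
  v_pos : ∀ l, 0 < v l
  RA_nonneg : 0 ≤ RA
  RS_nonneg : 0 ≤ RS
  q_nonneg : 0 ≤ q
  lo_lt_hi : lo < hi
  w_nonneg : 0 ≤ w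
  W_nonneg : 0 ≤ W
  H_nonneg : 0 ≤ H
  u_large : H < ∑ l ∈ Finset.range n, u l
  v_large : W * H < ∑ l ∈ Finset.range n, v l
  queue : ∀ t, 0 ≤ t → Q t = q + delayedCount u RA t - delayedCount v RS (A t)
  alloc_zero : A 0 = 0
  alloc_mono : ∀ s t, 0 ≤ s → s ≤ t → A s ≤ A t
  alloc_le : ∀ s t, 0 ≤ s → s ≤ t → A t - A s ≤ W * (t - s)
  alloc_slow : ∀ s t, 0 ≤ s → s ≤ t → (∀ τ ∈ Set.Ioo s t, Q τ < hi) → A t - A s ≤ w * (t - s)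
  alloc_stopped : ∀ (l : ℕ) (s t : ℝ), 0 ≤ s → s ≤ t → stopTime Q lo hi e l ≤ (s : EReal) →
    (t : EReal) ≤ resumeTime Q lo hi e l → A t = A s

namespace IsThresholdPath

variable {u v : ℕ → ℝ} {RA RS q lo hi w W H : ℝ} {e : Bool} {n : ℕ} {Q A : ℝ → ℝ}
  (h : IsThresholdPath u v RA RS q lo hi w W H e n Q A)

include h

lemma alloc_nonneg {t : ℝ} (ht : 0 ≤ t) : 0 ≤ A t := by
  have := h.alloc_mono 0 t le_rfl ht
  rwa [h.alloc_zero] at this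

lemma time_lt {t : ℝ} (htH : t ≤ H) : t < ∑ l ∈ Finset.range n, u l := htH.trans_lt h.u_large

lemma alloc_lt {t : ℝ} (ht : 0 ≤ t) (htH : t ≤ H) : A t < ∑ l ∈ Finset.range n, v l := by
  have h1 := h.alloc_le 0 t le_rfl ht
  rw [h.alloc_zero, sub_zero, sub_zero] at h1
  have h2 : W * t ≤ W * H := mul_le_mul_of_nonneg_left htH h.W_nonneg
  linarith [h.v_large]

lemma queue_zero : Q 0 = q := by
  rw [h.queue 0 le_rfl, h.alloc_zero, delayedCount_eq_startedCount_sub h.u_pos h.RA_nonneg 0 le_rfl,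
    delayedCount_eq_startedCount_sub h.v_pos h.RS_nonneg 0 le_rfl]
  have aux : ∀ (x : ℕ → ℝ) (R : ℝ), (∀ l, 0 < x l) → 0 ≤ R →
      (startedCount x R 0 : ℝ) = if R = 0 then 1 else 0 := by
    intro x R hx hR
    have hc := lt_startedCount_iff hx hR (n := 1) (t := 0) (by simpa using hx 0)
    have h1 : startedCount x R 0 ≤ 1 := startedCount_le hx hR (by simpa using hx 0)
    have h0 := hc 0
    simp only [Finset.range_zero, Finset.sum_empty, add_zero] at h0
    split_ifs with hR0
    · have : startedCount x R 0 = 1 := le_antisymm h1 (h0.2 hR0.le)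
      simp [this]
    · have : ¬ 0 < startedCount x R 0 := fun hh => hR0 (le_antisymm (h0.1 hh) hR)
      have : startedCount x R 0 = 0 := by omega
      simp [this]
  rw [aux u RA h.u_pos h.RA_nonneg, aux v RS h.v_pos h.RS_nonneg]
  ring

lemma queue_sub {s t : ℝ} (hs : 0 ≤ s) (ht : 0 ≤ t) :
    Q t - Q s = ((startedCount u RA t : ℝ) - startedCount u RA s) -
      ((startedCount v RS (A t) : ℝ) - startedCount v RS (A s)) := by
  rw [h.queue t ht, h.queue s hs, delayedCount_eq_startedCount_sub h.u_pos h.RA_nonneg _ ht,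
    delayedCount_eq_startedCount_sub h.u_pos h.RA_nonneg _ hs,
    delayedCount_eq_startedCount_sub h.v_pos h.RS_nonneg _ (h.alloc_nonneg ht),
    delayedCount_eq_startedCount_sub h.v_pos h.RS_nonneg _ (h.alloc_nonneg hs)]
  ring

lemma arrivals_mono {s t : ℝ} (hst : s ≤ t) (htH : t ≤ H) :
    startedCount u RA s ≤ startedCount u RA t :=
  startedCount_mono h.u_pos h.RA_nonneg hst (h.time_lt htH)

lemma services_mono {s t : ℝ} (hs : 0 ≤ s) (hst : s ≤ t) (htH : t ≤ H) :
    startedCount v RS (A s) ≤ startedCount v RS (A t) :=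
  startedCount_mono h.v_pos h.RS_nonneg (h.alloc_mono s t hs hst) (h.alloc_lt (hs.trans hst) htH)

lemma tendsto_alloc {t : ℝ} (ht : 0 ≤ t) : Tendsto A (𝓝[≥] t) (𝓝[≥] (A t)) := by
  refine tendsto_nhdsWithin_iff.2 ⟨?_, ?_⟩
  · have h1 : Tendsto (fun s => A t + W * (s - t)) (𝓝[≥] t) (𝓝 (A t)) := by
      have : Continuous fun s => A t + W * (s - t) := by fun_prop
      have h2 := this.tendsto t
      simp only [sub_self, mul_zero, add_zero] at h2
      exact h2.mono_left nhdsWithin_le_nhds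
    refine tendsto_of_tendsto_of_tendsto_of_le_of_le' tendsto_const_nhds h1 ?_ ?_
    · filter_upwards [self_mem_nhdsWithin] with s hs using h.alloc_mono t s ht hs
    · filter_upwards [self_mem_nhdsWithin] with s hs
      linarith [h.alloc_le t s ht hs]
  · filter_upwards [self_mem_nhdsWithin] with s hs using h.alloc_mono t s ht hs

lemma queue_eventually_eq (t : ℝ) (ht : 0 ≤ t) (htH : t ≤ H) : ∀ᶠ s in 𝓝[≥] t, Q s = Q t := by
  filter_upwards [self_mem_nhdsWithin,
    startedCount_eventually_eq h.u_pos h.RA_nonneg (h.time_lt htH),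
    (h.tendsto_alloc ht).eventually
      (startedCount_eventually_eq h.v_pos h.RS_nonneg (h.alloc_lt ht htH))] with s hs h1 h2
  have h3 : 0 ≤ s := ht.trans hs
  have := h.queue_sub ht h3
  rw [h1, h2] at this
  linarith

lemma exists_resumeTime {l : ℕ} (hl : resumeTime Q lo hi e l ≤ (H : EReal)) :
    ∃ τ : ℝ, 0 ≤ τ ∧ τ ≤ H ∧ resumeTime Q lo hi e l = τ ∧ hi ≤ Q τ :=
  exists_eq_hitTime h.queue_eventually_eq hl

/-- Completed services lower the queue one by one, hence it is at least `lo - 1` when it passes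
below `lo`. -/
lemma le_queue_of_hitTime {ρ σ : ℝ} (hρ : 0 ≤ ρ) (hσH : σ ≤ H) (hρσ : ρ ≤ σ)
    (hσ : hitTime Q (Set.Iio lo) ρ = σ) (hQρ : min lo 0 ≤ Q ρ) : min lo 0 - 1 ≤ Q σ := by
  rcases hρσ.eq_or_lt with rfl | hlt
  · linarith
  have hσ0 : 0 ≤ σ := hρ.trans hρσ
  obtain ⟨p, hp, hcount⟩ :=
    exists_startedCount_le_add_one h.v_pos h.RS_nonneg (h.alloc_lt hσ0 hσH)
  have hW : 0 < W + 1 := by linarith [h.W_nonneg]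
  have hpos : 0 < (A σ - p) / (W + 1) := div_pos (by linarith) hW
  set s := max ρ (σ - (A σ - p) / (W + 1)) with hs
  have hs1 : ρ ≤ s := le_max_left _ _
  have hs2 : s < σ := max_lt hlt (by linarith)
  have hs0 : 0 ≤ s := hρ.trans hs1
  have hlow : lo ≤ Q s := by
    by_contra hc
    have := hitTime_le (S := Set.Iio lo) (σ := (ρ : EReal)) hs0 (by exact_mod_cast hs1)
      (Set.mem_Iio.2 (not_le.1 hc))
    rw [hσ] at this
    exact absurd hs2 (not_lt.2 (by exact_mod_cast this))
  have hAs : p ≤ A s := by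
    have h1 := h.alloc_le s σ hs0 hs2.le
    have h2 : σ - s ≤ (A σ - p) / (W + 1) := by
      have := le_max_right ρ (σ - (A σ - p) / (W + 1)); linarith
    rw [le_div_iff₀ hW] at h2
    nlinarith
  have h1 : (startedCount v RS (A σ) : ℝ) ≤ startedCount v RS (A s) + 1 := by
    exact_mod_cast hcount (A s) hAs (h.alloc_mono s σ hs0 hs2.le)
  have h2 : (startedCount u RA s : ℝ) ≤ startedCount u RA σ := by
    exact_mod_cast h.arrivals_mono hs2.le hσH
  have h3 := h.queue_sub hs0 hσ0
  have h4 := min_le_left lo 0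
  linarith

lemma exists_stopTime_succ {l : ℕ} (hl : stopTime Q lo hi e (l + 1) ≤ (H : EReal)) :
    ∃ σ : ℝ, 0 ≤ σ ∧ σ ≤ H ∧ stopTime Q lo hi e (l + 1) = σ ∧ Q σ < lo :=
  exists_eq_hitTime h.queue_eventually_eq hl

lemma exists_stopTime {l : ℕ} (hl : stopTime Q lo hi e l ≤ (H : EReal)) :
    ∃ σ : ℝ, 0 ≤ σ ∧ σ ≤ H ∧ stopTime Q lo hi e l = σ ∧ min lo 0 - 1 ≤ Q σ := by
  have hq0 : min lo 0 ≤ Q 0 := by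
    rw [h.queue_zero]; exact (min_le_right _ _).trans h.q_nonneg
  cases l with
  | zero =>
    cases e with
    | true =>
      refine ⟨0, le_rfl, h.H_nonneg, by simp [stopTime], by linarith⟩
    | false =>
      have hl' : hitTime Q (Set.Iio lo) ((0 : ℝ) : EReal) ≤ (H : EReal) := by
        simpa [stopTime] using hl
      obtain ⟨σ, h0, hH, heq, -⟩ := exists_eq_hitTime h.queue_eventually_eq hl'
      exact ⟨σ, h0, hH, by simpa [stopTime] using heq, h.le_queue_of_hitTime le_rfl hH h0 heq hq0⟩
  | succ l =>
    obtain ⟨σ, h0, hH, heq, -⟩ := h.exists_stopTime_succ hl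
    have hle := resumeTime_le_stopTime_succ Q lo hi e l
    obtain ⟨ρ, hρ0, -, hρ, hQρ⟩ := h.exists_resumeTime (hle.trans hl)
    refine ⟨σ, h0, hH, heq, h.le_queue_of_hitTime hρ0 hH ?_ ?_ ?_⟩
    · rw [hρ, heq] at hle; exact_mod_cast hle
    · rw [← hρ]; exact heq
    · exact (min_le_left _ _).trans (h.lo_lt_hi.le.trans hQρ)

/-- The queue is resumed after a new arrival only. -/
lemma arrivals_add_one_le {l : ℕ} {s τ : ℝ} (hs : 0 ≤ s) (hsτ : s ≤ τ)
    (h1 : stopTime Q lo hi e l ≤ (s : EReal)) (h2 : (τ : EReal) = resumeTime Q lo hi e l)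
    (hQs : Q s < hi) (hQτ : hi ≤ Q τ) : startedCount u RA s + 1 ≤ startedCount u RA τ := by
  have h3 := h.queue_sub hs (hs.trans hsτ)
  rw [h.alloc_stopped l s τ hs hsτ h1 h2.le] at h3
  have h4 : (startedCount u RA s : ℝ) < startedCount u RA τ := by linarith
  exact_mod_cast h4

/-- Before the queue falls below `lo`, there is a last time `s` close to which it is at least `hi`.
After this last time the allocation rate is at most `w`; the summand `1` covers the time from `s`
to it. -/
lemma exists_last_time {ρ σ : ℝ} (hρ : 0 ≤ ρ) (hρσ : ρ ≤ σ) (hQρ : hi ≤ Q ρ) :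
    ∃ s, ρ ≤ s ∧ s ≤ σ ∧ hi ≤ Q s ∧ A σ - A s ≤ w * (σ - s) + 1 := by
  set S : Set ℝ := {t | t ∈ Set.Icc ρ σ ∧ hi ≤ Q t}
  have hne : S.Nonempty := ⟨ρ, ⟨le_rfl, hρσ⟩, hQρ⟩
  have hbdd : BddAbove S := ⟨σ, fun t ht => ht.1.2⟩
  have hW : 0 < W + 1 := by linarith [h.W_nonneg]
  have hlt : sSup S - 1 / (W + 1) < sSup S := by
    have : 0 < 1 / (W + 1) := by positivity
    linarith
  obtain ⟨s, hsS, hs⟩ := exists_lt_of_lt_csSup hne hlt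
  have hsle : s ≤ sSup S := le_csSup hbdd hsS
  have hSσ : sSup S ≤ σ := csSup_le hne fun t ht => ht.1.2
  have hs0 : 0 ≤ s := hρ.trans hsS.1.1
  refine ⟨s, hsS.1.1, hsS.1.2, hsS.2, ?_⟩
  have h1 := h.alloc_le s (sSup S) hs0 hsle
  have h2 := h.alloc_slow (sSup S) σ (hs0.trans hsle) hSσ fun τ hτ => by
    by_contra hc
    exact absurd (le_csSup hbdd ⟨⟨hsS.1.1.trans (hsle.trans hτ.1.le), hτ.2.le⟩, not_lt.1 hc⟩)
      (not_le.2 hτ.1)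
  have h3 : W * (sSup S - s) ≤ 1 := by
    have h4 : sSup S - s ≤ 1 / (W + 1) := by linarith
    rw [le_div_iff₀ hW] at h4
    nlinarith
  have h5 : w * (σ - sSup S) ≤ w * (σ - s) :=
    mul_le_mul_of_nonneg_left (by linarith) h.w_nonneg
  linarith

section Crossing

variable {cU cV x : ℝ} (hx : 0 ≤ x) (hcU : 0 ≤ cU) (hcV : 0 ≤ cV) (hc : w * cU ≤ cV)

include hx hcV hc in
/-- A passage from `hi` to `lo` needs slow arrivals or fast services: it raises the gains. -/
lemma gain_of_crossing {s₀ ρ σ : ℝ} (hs₀ : 0 ≤ s₀) (hsρ : s₀ ≤ ρ) (hρσ : ρ ≤ σ) (hσH : σ ≤ H)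
    (hQρ : hi ≤ Q ρ) (hQσ : Q σ < lo)
    (harr : startedCount u RA s₀ + 1 ≤ startedCount u RA ρ) :
    w * blockGain (fun l => u l - cU) x (startedCount u RA s₀) +
        blockGain (fun l => cV - v l) x (startedCount v RS (A s₀)) +
        (cV * (hi - lo - 2) - 1 - (1 + w) * x) ≤
      w * blockGain (fun l => u l - cU) x (startedCount u RA σ) +
        blockGain (fun l => cV - v l) x (startedCount v RS (A σ)) := by
  have hρ0 : 0 ≤ ρ := hs₀.trans hsρ
  obtain ⟨s, hρs, hsσ, hQs, hA⟩ := h.exists_last_time hρ0 hρσ hQρ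
  have hs0 : 0 ≤ s := hρ0.trans hρs
  have hσ0 : 0 ≤ σ := hs0.trans hsσ
  have hdiff := h.queue_sub hs0 hσ0
  set n₁ := startedCount u RA s with hn₁
  set n₂ := startedCount u RA σ with hn₂
  set m₁ := startedCount v RS (A s) with hm₁
  set m₂ := startedCount v RS (A σ) with hm₂
  have hn12 : n₁ ≤ n₂ := h.arrivals_mono hsσ hσH
  have hn01 : startedCount u RA s₀ ≤ n₁ - 1 := by
    have := h.arrivals_mono hρs (hsσ.trans hσH); omega
  have hn1 : 1 ≤ n₁ := by
    have := h.arrivals_mono hρs (hsσ.trans hσH); omega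
  have hm01 : startedCount v RS (A s₀) ≤ m₁ :=
    h.services_mono hs₀ (hsρ.trans hρs) (hsσ.trans hσH)
  have hn12' : (n₁ : ℝ) ≤ n₂ := by exact_mod_cast hn12
  have hm12 : m₁ + 1 ≤ m₂ := by
    have : (m₁ : ℝ) < m₂ := by linarith [h.lo_lt_hi]
    exact_mod_cast this
  have hU : σ - s ≤ ∑ l ∈ Finset.Ico (n₁ - 1) n₂, u l :=
    sub_le_sum_Ico_startedCount h.u_pos h.RA_nonneg hsσ (h.time_lt hσH) hn1
  have hV : ∑ l ∈ Finset.Ico m₁ (m₂ - 1), v l ≤ A σ - A s :=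
    sum_Ico_startedCount_le_sub h.v_pos h.RS_nonneg (h.alloc_mono s σ hs0 hsσ)
      (h.alloc_lt hσ0 hσH) hm12
  have gU := blockGain_add_le (fun l => u l - cU) hx (show n₁ - 1 ≤ n₂ by omega)
  have gV := blockGain_add_le (fun l => cV - v l) hx (show m₁ ≤ m₂ - 1 by omega)
  have mU := blockGain_mono (fun l => u l - cU) x hn01
  have mV := blockGain_mono (fun l => cV - v l) x hm01
  have mV' := blockGain_mono (fun l => cV - v l) x (show m₂ - 1 ≤ m₂ by omega)
  rw [Finset.sum_sub_distrib, Finset.sum_const, Nat.card_Ico, nsmul_eq_mul] at gU gV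
  have e1 : ((n₂ - (n₁ - 1) : ℕ) : ℝ) = n₂ - n₁ + 1 := by
    rw [Nat.cast_sub (by omega), Nat.cast_sub hn1]; push_cast; ring
  have e2 : ((m₂ - 1 - m₁ : ℕ) : ℝ) = m₂ - m₁ - 1 := by
    rw [Nat.cast_sub (by omega), Nat.cast_sub (by omega)]; push_cast; ring
  rw [e1] at gU
  rw [e2] at gV
  have hw := h.w_nonneg
  have hwU := mul_le_mul_of_nonneg_left (mU.trans (by linarith [gU, hU] :
    blockGain (fun l => u l - cU) x (n₁ - 1) ≤ blockGain (fun l => u l - cU) x n₂ -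
      ((σ - s) - (n₂ - n₁ + 1) * cU - x))) hw
  have h1 : 0 ≤ (cV - w * cU) * (n₂ - n₁ + 1) :=
    mul_nonneg (by linarith) (by linarith)
  have h2 : 0 ≤ cV * ((m₂ - m₁) - (n₂ - n₁) - (hi - lo)) := by
    apply mul_nonneg hcV; linarith
  nlinarith

include hx hcV hc in
/-- The number of stops up to `H` is bounded by the maximal gains. -/
lemma mul_le_gain {k : ℕ} (hk : stopTime Q lo hi e (k + 1) ≤ (H : EReal)) :
    k * (cV * (hi - lo - 2) - 1 - (1 + w) * x) ≤
      w * blockGain (fun l => u l - cU) x n + blockGain (fun l => cV - v l) x n := by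
  suffices hs : ∀ k σ, 0 ≤ σ → σ ≤ H → stopTime Q lo hi e (k + 1) = ((σ : ℝ) : EReal) →
      k * (cV * (hi - lo - 2) - 1 - (1 + w) * x) ≤
        w * blockGain (fun l => u l - cU) x (startedCount u RA σ) +
          blockGain (fun l => cV - v l) x (startedCount v RS (A σ)) by
    obtain ⟨σ, h0, hH, heq, -⟩ := h.exists_stopTime_succ hk
    refine (hs k σ h0 hH heq).trans (add_le_add (mul_le_mul_of_nonneg_left ?_ h.w_nonneg) ?_)
    · exact blockGain_mono _ _ (startedCount_le h.u_pos h.RA_nonneg (h.time_lt hH))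
    · exact blockGain_mono _ _ (startedCount_le h.v_pos h.RS_nonneg (h.alloc_lt h0 hH))
  intro k
  induction k with
  | zero =>
    intro σ _ _ _
    have h1 := mul_nonneg h.w_nonneg (blockGain_nonneg (fun l => u l - cU) x (startedCount u RA σ))
    have h2 := blockGain_nonneg (fun l => cV - v l) x (startedCount v RS (A σ))
    push_cast
    linarith
  | succ k ih =>
    intro σ h0 hH heq
    have hle := resumeTime_le_stopTime_succ Q lo hi e (k + 1)
    obtain ⟨ρ, hρ0, hρH, hρ, hQρ⟩ := h.exists_resumeTime (hle.trans (by
      rw [heq]; exact_mod_cast hH))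
    have hle' := stopTime_le_resumeTime Q lo hi e (k + 1)
    obtain ⟨s, hs0, hsH, hs, hQs⟩ := h.exists_stopTime_succ (hle'.trans (by
      rw [hρ]; exact_mod_cast hρH))
    obtain ⟨σ', -, -, hσ', hQσ⟩ := h.exists_stopTime_succ (l := k + 1) (by
      rw [heq]; exact_mod_cast hH)
    obtain rfl : σ = σ' := by rw [heq] at hσ'; exact_mod_cast hσ'
    have hsρ : s ≤ ρ := by rw [hs, hρ] at hle'; exact_mod_cast hle'
    have hρσ : ρ ≤ σ := by rw [hρ, heq] at hle; exact_mod_cast hle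
    have h1 := ih s hs0 hsH hs
    have h2 := h.gain_of_crossing hx hcV hc hs0 hsρ hρσ hH hQρ hQσ
      (h.arrivals_add_one_le hs0 hsρ hs.le hρ.symm (hQs.trans h.lo_lt_hi) hQρ)
    push_cast
    linarith

include hx hcU in
/-- The length of a stop after the residual arrival time `RA`, up to a time `t` at which the queue
is still stopped. At most `hi - min lo 0 + 1` jobs arrive before. -/
lemma sub_le_gain {l : ℕ} {σ t : ℝ} (hσ : stopTime Q lo hi e l = ((σ : ℝ) : EReal)) (hσ0 : 0 ≤ σ)
    (hσt : σ ≤ t) (htH : t ≤ H) (hRt : RA ≤ t) (ht : (t : EReal) < resumeTime Q lo hi e l) :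
    t - max σ RA + blockGain (fun l => u l - cU) x (startedCount u RA (max σ RA) - 1) ≤
      x + cU * (hi - min lo 0 + 2) + blockGain (fun l => u l - cU) x (startedCount u RA t) := by
  have hσH : σ ≤ H := hσt.trans htH
  set s := max σ RA with hs
  have hst : s ≤ t := max_le hσt hRt
  have hσs : σ ≤ s := le_max_left _ _
  have hs1 : 1 ≤ startedCount u RA s :=
    (one_le_startedCount_iff h.u_pos h.RA_nonneg (h.time_lt (hst.trans htH))).2 (le_max_right _ _)
  have hU := sub_le_sum_Ico_startedCount h.u_pos h.RA_nonneg hst (h.time_lt htH) hs1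
  have hmono := h.arrivals_mono hst htH
  have gU := blockGain_add_le (fun l => u l - cU) hx
    (show startedCount u RA s - 1 ≤ startedCount u RA t by omega)
  rw [Finset.sum_sub_distrib, Finset.sum_const, Nat.card_Ico, nsmul_eq_mul] at gU
  have e1 : ((startedCount u RA t - (startedCount u RA s - 1) : ℕ) : ℝ) =
      startedCount u RA t - startedCount u RA s + 1 := by
    rw [Nat.cast_sub (by omega), Nat.cast_sub hs1]; push_cast; ring
  rw [e1] at gU
  have hQt : Q t < hi :=
    lt_of_lt_resumeTime Q lo hi e (by rw [hσ]; exact_mod_cast hσt) ht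
  obtain ⟨σ', -, -, hσ', hQσ⟩ := h.exists_stopTime (l := l) (by rw [hσ]; exact_mod_cast hσH)
  obtain rfl : σ = σ' := by rw [hσ] at hσ'; exact_mod_cast hσ'
  have hd := h.queue_sub hσ0 (hσ0.trans hσt)
  rw [h.alloc_stopped l σ t hσ0 hσt hσ.le ht.le] at hd
  have hm2 : (startedCount u RA σ : ℝ) ≤ startedCount u RA s := by
    exact_mod_cast h.arrivals_mono hσs (hst.trans htH)
  have h1 : (startedCount u RA t : ℝ) - startedCount u RA s + 1 ≤ hi - min lo 0 + 2 := by
    linarith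
  have h2 := mul_le_mul_of_nonneg_right h1 hcU
  linarith

include hx hcU in
lemma volume_stopPart_le {l : ℕ} {σ : ℝ} (hσ : stopTime Q lo hi e l = ((σ : ℝ) : EReal))
    (hσ0 : 0 ≤ σ) :
    volume (stopPart Q RA lo hi H e l) = 0 ∨ ∃ t, σ ≤ t ∧ t ≤ H ∧ RA ≤ t ∧
      (t : EReal) < resumeTime Q lo hi e l ∧
      volume (stopPart Q RA lo hi H e l) ≤ ENNReal.ofReal (1 + x + cU * (hi - min lo 0 + 2) +
        blockGain (fun l => u l - cU) x (startedCount u RA t) -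
        blockGain (fun l => u l - cU) x (startedCount u RA (max σ RA) - 1)) := by
  rcases (stopPart Q RA lo hi H e l).eq_empty_or_nonempty with hemp | hne
  · left; rw [hemp]; simp
  right
  have hbdd : BddAbove (stopPart Q RA lo hi H e l) := ⟨H, fun t ht => ht.2.2⟩
  obtain ⟨t, ht, hlt⟩ := exists_lt_of_lt_csSup hne (sub_one_lt (sSup (stopPart Q RA lo hi H e l)))
  have hσt : σ ≤ t := by have := ht.1.1; rw [hσ] at this; exact_mod_cast this
  refine ⟨t, hσt, ht.2.2, ht.2.1.le, ht.1.2, ?_⟩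
  have hsub : stopPart Q RA lo hi H e l ⊆ Set.Icc (max σ RA) (t + 1) := by
    intro s hs
    refine ⟨max_le ?_ hs.2.1.le, ?_⟩
    · have := hs.1.1; rw [hσ] at this; exact_mod_cast this
    · have := le_csSup hbdd hs; linarith
  refine (measure_mono hsub).trans ?_
  rw [Real.volume_Icc]
  apply ENNReal.ofReal_le_ofReal
  have := h.sub_le_gain hx hcU hσ hσ0 hσt ht.2.2 ht.2.1.le ht.1.2
  linarith

include hx hcU in
lemma volume_stopPart_le_gain (l : ℕ) :
    volume (stopPart Q RA lo hi H e l) ≤ ENNReal.ofReal (1 + x + cU * (hi - min lo 0 + 2) +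
      blockGain (fun l => u l - cU) x n) := by
  by_cases hl : stopTime Q lo hi e l ≤ (H : EReal)
  · obtain ⟨σ, hσ0, -, hσ, -⟩ := h.exists_stopTime hl
    rcases h.volume_stopPart_le hx hcU hσ hσ0 with h0 | ⟨t, -, htH, -, -, hv⟩
    · rw [h0]; exact zero_le
    · refine hv.trans (ENNReal.ofReal_le_ofReal ?_)
      have h1 := blockGain_mono (fun l => u l - cU) x
        (startedCount_le h.u_pos h.RA_nonneg (h.time_lt htH))
      have h2 := blockGain_nonneg (fun l => u l - cU) x (startedCount u RA (max σ RA) - 1)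
      linarith
  · rw [stopPart_eq_empty hl]; simp

/-- From the third stop on, a new job has arrived before. -/
lemma RA_le_stopTime {l : ℕ} {σ : ℝ} (hl : 2 ≤ l)
    (hσ : stopTime Q lo hi e l = ((σ : ℝ) : EReal)) (hσH : σ ≤ H) : RA ≤ σ := by
  have h2 : stopTime Q lo hi e 2 ≤ (σ : EReal) := hσ ▸ stopTime_mono Q lo hi e hl
  have h3 : resumeTime Q lo hi e 1 ≤ (σ : EReal) :=
    (resumeTime_le_stopTime_succ Q lo hi e 1).trans h2
  obtain ⟨ρ, hρ0, hρH, hρ, hQρ⟩ := h.exists_resumeTime (h3.trans (by exact_mod_cast hσH))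
  have h4 := stopTime_le_resumeTime Q lo hi e 1
  obtain ⟨s, hs0, hsH, hs, hQs⟩ := h.exists_stopTime_succ (l := 0)
    (h4.trans (h3.trans (by exact_mod_cast hσH)))
  rw [zero_add] at hs
  have hsρ : s ≤ ρ := by rw [hs, hρ] at h4; exact_mod_cast h4
  have := h.arrivals_add_one_le hs0 hsρ hs.le hρ.symm (hQs.trans h.lo_lt_hi) hQρ
  have h5 := (one_le_startedCount_iff h.u_pos h.RA_nonneg (h.time_lt hρH)).1 (by omega)
  refine h5.trans ?_
  rw [hρ] at h3; exact_mod_cast h3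

include hx hcU in
/-- The interarrival times during different stops are disjoint blocks. Hence the total length of the
stops exceeds the sum of their typical lengths by at most the maximal gain. -/
lemma sum_volume_stopPart_le (k : ℕ) :
    ∑ l ∈ Finset.range k, volume (stopPart Q RA lo hi H e (l + 2)) ≤
      ENNReal.ofReal (k * (1 + x + cU * (hi - min lo 0 + 2)) +
        blockGain (fun l => u l - cU) x n) := by
  have hM : 0 ≤ hi - min lo 0 + 2 := by
    have := min_le_left lo 0; linarith [h.lo_lt_hi]
  have hDpos : 0 ≤ 1 + x + cU * (hi - min lo 0 + 2) := by
    have := mul_nonneg hcU hM; linarith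
  set D := 1 + x + cU * (hi - min lo 0 + 2) with hD
  -- the first index not used by the stops before the one with number `k + 2`
  let g : ℕ → ℕ := fun k => if stopTime Q lo hi e (k + 2) ≤ (H : EReal)
    then startedCount u RA (stopTime Q lo hi e (k + 2)).toReal - 1 else n
  have hgn : ∀ k, g k ≤ n := by
    intro k
    simp only [g]
    split_ifs with hk
    · obtain ⟨σ, h0, hH, hσ, -⟩ := h.exists_stopTime hk
      rw [hσ, EReal.toReal_coe]
      exact (Nat.sub_le _ _).trans (startedCount_le h.u_pos h.RA_nonneg (h.time_lt hH))
    · exact le_rfl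
  suffices hs : ∑ l ∈ Finset.range k, volume (stopPart Q RA lo hi H e (l + 2)) ≤
      ENNReal.ofReal (k * D + blockGain (fun l => u l - cU) x (g k)) by
    refine hs.trans (ENNReal.ofReal_le_ofReal ?_)
    have := blockGain_mono (fun l => u l - cU) x (hgn k)
    linarith
  induction k with
  | zero => simp
  | succ k ih =>
    rw [Finset.sum_range_succ]
    have hG := blockGain_nonneg (fun l => u l - cU) x
    by_cases hk : stopTime Q lo hi e (k + 2) ≤ (H : EReal)
    · obtain ⟨σ, hσ0, hσH, hσ, -⟩ := h.exists_stopTime hk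
      have hRσ := h.RA_le_stopTime (by omega) hσ hσH
      have hgk : g k = startedCount u RA σ - 1 := by
        simp only [g, if_pos hk]; rw [hσ, EReal.toReal_coe]
      have hgmono : g k ≤ g (k + 1) := by
        rw [hgk]
        simp only [g]
        split_ifs with hk'
        · obtain ⟨σ', hσ0', hσH', hσ', -⟩ := h.exists_stopTime hk'
          rw [hσ', EReal.toReal_coe]
          have : σ ≤ σ' := by
            have := stopTime_mono Q lo hi e (show k + 2 ≤ k + 1 + 2 by omega)
            rw [hσ, hσ'] at this; exact_mod_cast this
          have := h.arrivals_mono this hσH'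
          omega
        · exact (Nat.sub_le _ _).trans (startedCount_le h.u_pos h.RA_nonneg (h.time_lt hσH))
      rcases h.volume_stopPart_le hx hcU hσ hσ0 with h0 | ⟨t, hσt, htH, -, ht, hv⟩
      · rw [h0, add_zero]
        refine ih.trans (ENNReal.ofReal_le_ofReal ?_)
        have := blockGain_mono (fun l => u l - cU) x hgmono
        push_cast
        linarith
      · have htg : startedCount u RA t ≤ g (k + 1) := by
          simp only [g]
          split_ifs with hk'
          · obtain ⟨σ', hσ0', hσH', hσ', -⟩ := h.exists_stopTime hk'
            rw [hσ', EReal.toReal_coe]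
            have hle := resumeTime_le_stopTime_succ Q lo hi e (k + 2)
            obtain ⟨ρ, hρ0, hρH, hρ, hQρ⟩ := h.exists_resumeTime (hle.trans hk')
            have htρ : t ≤ ρ := by rw [hρ] at ht; exact_mod_cast ht.le
            have hρσ : ρ ≤ σ' := by
              rw [hρ] at hle
              have hle2 := hle.trans_eq hσ'
              exact_mod_cast hle2
            have hst : stopTime Q lo hi e (k + 2) ≤ (t : EReal) := by
              rw [hσ]; exact_mod_cast hσt
            have h1 := h.arrivals_add_one_le (hσ0.trans hσt) htρ hst hρ.symm
              (lt_of_lt_resumeTime Q lo hi e hst ht) hQρ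
            have h2 := h.arrivals_mono hρσ hσH'
            omega
          · exact startedCount_le h.u_pos h.RA_nonneg (h.time_lt htH)
        refine (add_le_add ih hv).trans ?_
        rw [max_eq_left hRσ, ← hgk, ← ENNReal.ofReal_add]
        · apply ENNReal.ofReal_le_ofReal
          have := blockGain_mono (fun l => u l - cU) x htg
          push_cast
          linarith
        · exact add_nonneg (mul_nonneg (Nat.cast_nonneg _) hDpos) (hG _)
        · have h1 : g k ≤ startedCount u RA t := by
            rw [hgk]
            have := h.arrivals_mono hσt htH
            omega
          have := blockGain_mono (fun l => u l - cU) x h1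
          linarith
    · have hk' : ¬ stopTime Q lo hi e (k + 1 + 2) ≤ (H : EReal) := fun hc =>
        hk ((stopTime_mono Q lo hi e (by omega)).trans hc)
      have hg : g (k + 1) = g k := by simp only [g, if_neg hk, if_neg hk']
      rw [stopPart_eq_empty hk, measure_empty, add_zero, hg]
      refine ih.trans (ENNReal.ofReal_le_ofReal ?_)
      push_cast
      linarith

include hx hcU hcV hc in
/-- If all maximal gains are at most `y`, the total stopped time is at most the residual arrival
time plus a bounded number of typical lengths of a stop, up to multiples of `y`. -/
theorem volume_stoppedSet_le {y : ℝ} (hG : 0 < cV * (hi - lo - 2) - 1 - (1 + w) * x)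
    (hyU : blockGain (fun l => u l - cU) x n ≤ y) (hyV : blockGain (fun l => cV - v l) x n ≤ y) :
    volume (stoppedSet Q lo hi e ∩ Set.Ioc 0 H) ≤ ENNReal.ofReal (RA +
      ((1 + w) * y / (cV * (hi - lo - 2) - 1 - (1 + w) * x) + 2) *
        (1 + x + cU * (hi - min lo 0 + 2)) + 3 * y) := by
  set G := cV * (hi - lo - 2) - 1 - (1 + w) * x with hGdef
  have hM : 0 ≤ hi - min lo 0 + 2 := by
    have := min_le_left lo 0; linarith [h.lo_lt_hi]
  have hDpos : 0 ≤ 1 + x + cU * (hi - min lo 0 + 2) := by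
    have := mul_nonneg hcU hM; linarith
  have hy0 : 0 ≤ y := (blockGain_nonneg _ _ _).trans hyU
  have hYpos : 0 ≤ (1 + w) * y / G :=
    div_nonneg (mul_nonneg (by linarith [h.w_nonneg]) hy0) hG.le
  set K := ⌊(1 + w) * y / G⌋₊ with hK
  have hfew : ∀ l, stopTime Q lo hi e l ≤ (H : EReal) → l < K + 2 := by
    intro l hl
    rcases Nat.eq_zero_or_pos l with rfl | hpos
    · omega
    obtain ⟨k, rfl⟩ : ∃ k, l = k + 1 := ⟨l - 1, by omega⟩
    have h1 := h.mul_le_gain hx hcV hc hl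
    have h2 : (k : ℝ) ≤ (1 + w) * y / G := by
      rw [le_div_iff₀ hG]
      have := mul_le_mul_of_nonneg_left hyU h.w_nonneg
      linarith
    have := Nat.le_floor h2
    omega
  set D := 1 + x + cU * (hi - min lo 0 + 2) with hD
  have hsub : stoppedSet Q lo hi e ∩ Set.Ioc 0 H ⊆
      Set.Ioc 0 RA ∪ ⋃ l ∈ Finset.range (K + 2), stopPart Q RA lo hi H e l := by
    rintro t ⟨ht, ht0, htH⟩
    rcases le_or_gt t RA with hR | hR
    · exact Or.inl ⟨ht0, hR⟩
    · right
      obtain ⟨l, hl⟩ := Set.mem_iUnion.1 ht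
      simp only [Set.mem_iUnion]
      refine ⟨l, ?_, hl, hR, htH⟩
      exact Finset.mem_range.2 (hfew l (hl.1.trans (by exact_mod_cast htH)))
  have hv := h.volume_stopPart_le_gain hx hcU
  have hKle : (K : ℝ) ≤ (1 + w) * y / G := Nat.floor_le hYpos
  have hRA := h.RA_nonneg
  have hgn := blockGain_nonneg (fun l => u l - cU) x n
  calc volume (stoppedSet Q lo hi e ∩ Set.Ioc 0 H)
      ≤ volume (Set.Ioc 0 RA) +
          ∑ l ∈ Finset.range (K + 2), volume (stopPart Q RA lo hi H e l) :=
        (measure_mono hsub).trans ((measure_union_le _ _).trans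
          (by gcongr; exact measure_biUnion_finset_le _ _))
    _ = ENNReal.ofReal RA + (∑ l ∈ Finset.range K, volume (stopPart Q RA lo hi H e (l + 2)) +
          volume (stopPart Q RA lo hi H e 1) + volume (stopPart Q RA lo hi H e 0)) := by
        rw [Real.volume_Ioc, sub_zero, Finset.sum_range_succ', Finset.sum_range_succ']
    _ ≤ ENNReal.ofReal RA + (ENNReal.ofReal (K * D + blockGain (fun l => u l - cU) x n) +
          ENNReal.ofReal (D + blockGain (fun l => u l - cU) x n) +
          ENNReal.ofReal (D + blockGain (fun l => u l - cU) x n)) := by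
        gcongr
        · exact h.sum_volume_stopPart_le hx hcU K
        · exact hv 1
        · exact hv 0
    _ = ENNReal.ofReal (RA + ((K * D + blockGain (fun l => u l - cU) x n) +
          (D + blockGain (fun l => u l - cU) x n) + (D + blockGain (fun l => u l - cU) x n))) := by
        have h1 : (0 : ℝ) ≤ K * D := by positivity
        rw [← ENNReal.ofReal_add, ← ENNReal.ofReal_add, ← ENNReal.ofReal_add] <;> linarith
    _ ≤ _ := by
        apply ENNReal.ofReal_le_ofReal
        have := mul_le_mul_of_nonneg_right hKle hDpos
        linarith

end Crossing

end IsThresholdPath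

/-! ### The policy yields threshold paths -/

section Policy

variable {I J : ℕ} (N : Network I J) (p : Policy J)

/-- The allocation rate of type `j` in the configuration `z`, if `j` is not stopped. -/
noncomputable def configRate (z : Fin J → Bool) (j : Fin J) : ℝ :=
  open Classical in N.ρ j - (if z ∈ N.reducible p.e then p.vc z j else 0) - p.vb z j

variable {N p}

lemma configRate_nonneg (hp : p.IsValid N) (hρ : ∀ j, 0 ≤ N.ρ j) (z : Fin J → Bool) (j : Fin J) :
    0 ≤ configRate N p z j := by
  have h0 : 0 ≤ N.ρmin := Real.iInf_nonneg hρ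
  have h1 : p.vb z j ≤ N.ρmin / 4 :=
    (le_abs_self _).trans ((norm_le_pi_norm (p.vb z) j).trans (hp.vb_le z))
  unfold configRate
  split_ifs with hz
  · linarith [hp.vc_lt z hz j]
  · have h2 : N.ρmin ≤ N.ρ j := ciInf_le (Set.finite_range _).bddBelow j
    linarith

lemma configRate_lt (hp : p.IsValid N) {z : Fin J → Bool} {j : Fin J} (hz : z j = true) :
    configRate N p z j < N.ρ j := by
  have h1 := hp.vb_pos z j hz
  unfold configRate
  split_ifs with h
  · linarith [hp.vc_nonneg z h j hz]
  · linarith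

/-- Since there are finitely many configurations, the rates are bounded, and the rates of a queue
below its upper threshold are bounded away from `ρ`. -/
lemma exists_configRate_le (hp : p.IsValid N) (hρ : ∀ j, 0 ≤ N.ρ j) (j : Fin J) :
    ∃ w W : ℝ, 0 ≤ w ∧ w < N.ρ j ∧ 0 ≤ W ∧ (∀ z, configRate N p z j ≤ W) ∧
      ∀ z, z j = true → configRate N p z j ≤ w := by
  classical
  obtain ⟨z₁, -, h₁⟩ := Finset.exists_max_image Finset.univ (fun z => configRate N p z j)
    Finset.univ_nonempty
  obtain ⟨z₂, hz₂, h₂⟩ := Finset.exists_max_image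
    (Finset.univ.filter fun z : Fin J → Bool => z j = true) (fun z => configRate N p z j)
    ⟨fun _ => true, by simp⟩
  exact ⟨_, _, configRate_nonneg hp hρ z₂ j, configRate_lt hp (Finset.mem_filter.1 hz₂).2,
    configRate_nonneg hp hρ z₁ j, fun z => h₁ z (Finset.mem_univ z),
    fun z hz => h₂ z (by simp [hz])⟩

lemma allocRate_eq {r : ℕ} {y : State J r} {Q : ℝ → Fin J → ℝ} {t : ℝ} {j : Fin J} [Decidable
    (t ∈ stopped N p r y Q j)] : allocRate N p r y Q t j =
      if t ∈ stopped N p r y Q j then 0 else configRate N p (nearEmpty N p r Q t) j := by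
  unfold allocRate configRate
  split_ifs <;> rfl

lemma IsPolicyPath.isThresholdPath {r : ℕ} {y : State J r} {u v : Fin J → ℕ → ℝ}
    {Q A : ℝ → Fin J → ℝ} (h : IsPolicyPath N p r y u v Q A) (hp : p.IsValid N)
    (hρ : ∀ j, 0 ≤ N.ρ j) {j : Fin J} (hu : ∀ l, 0 < u j l) (hv : ∀ l, 0 < v j l)
    (hlohi : p.lower N r < p.upper N r) {w W H : ℝ} (hw : 0 ≤ w) (hW : 0 ≤ W) (hH : 0 ≤ H)
    (hzW : ∀ z, configRate N p z j ≤ W) (hzw : ∀ z, z j = true → configRate N p z j ≤ w) {n : ℕ}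
    (hun : H < ∑ l ∈ Finset.range n, u j l) (hvn : W * H < ∑ l ∈ Finset.range n, v j l) :
    IsThresholdPath (u j) (v j) (r * y.ΥA j) (r * y.ΥS j) (r * y.q j) (p.lower N r) (p.upper N r)
      w W H (y.E j) n (fun t => Q t j) (fun t => A t j) := by
  classical
  have hint : ∀ s t, 0 ≤ s → 0 ≤ t →
      IntervalIntegrable (fun τ => allocRate N p r y Q τ j) volume s t := fun s t hs ht =>
    (h.integrable s hs j).symm.trans (h.integrable t ht j)
  have hsub : ∀ s t, 0 ≤ s → 0 ≤ t → A t j - A s j = ∫ τ in s..t, allocRate N p r y Q τ j := by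
    intro s t hs ht
    rw [h.alloc t ht j, h.alloc s hs j]
    exact intervalIntegral.integral_interval_sub_left (h.integrable t ht j) (h.integrable s hs j)
  have hle : ∀ s t c, 0 ≤ s → s ≤ t → (∀ τ ∈ Set.Ioo s t, allocRate N p r y Q τ j ≤ c) →
      A t j - A s j ≤ c * (t - s) := by
    intro s t c hs hst hc
    rw [hsub s t hs (hs.trans hst)]
    calc ∫ τ in s..t, allocRate N p r y Q τ j ≤ ∫ _ in s..t, c :=
          intervalIntegral.integral_mono_on_of_le_Ioo hst (hint s t hs (hs.trans hst))
            intervalIntegrable_const hc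
      _ = c * (t - s) := by rw [intervalIntegral.integral_const, smul_eq_mul, mul_comm]
  have hrate0 : ∀ t, 0 ≤ allocRate N p r y Q t j := by
    intro t
    rw [allocRate_eq]
    split_ifs
    exacts [le_rfl, configRate_nonneg hp hρ _ _]
  have hmono : ∀ s t, 0 ≤ s → s ≤ t → A s j ≤ A t j := by
    intro s t hs hst
    have h1 := hsub s t hs (hs.trans hst)
    have h2 := intervalIntegral.integral_nonneg (μ := volume) hst fun τ _ => hrate0 τ
    linarith
  refine ⟨hu, hv, mul_nonneg (Nat.cast_nonneg _) (y.ΥA_nonneg j),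
    mul_nonneg (Nat.cast_nonneg _) (y.ΥS_nonneg j), ?_, hlohi, hw, hW, hH, hun, hvn,
    fun t ht => h.queue t ht j, ?_, hmono, ?_, ?_, ?_⟩
  · obtain ⟨k, hk⟩ := y.q_mem j
    rw [hk]; positivity
  · simpa using h.alloc 0 le_rfl j
  · intro s t hs hst
    refine hle s t W hs hst fun τ _ => ?_
    rw [allocRate_eq]
    split_ifs
    exacts [hW, hzW _]
  · intro s t hs hst hlow
    refine hle s t w hs hst fun τ hτ => ?_
    rw [allocRate_eq]
    split_ifs
    · exact hw
    · exact hzw _ (by simpa [nearEmpty] using hlow τ hτ)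
  · intro l s t hs hst h1 h2
    refine le_antisymm ?_ (hmono s t hs hst)
    have := hle s t 0 hs hst fun τ hτ => by
      rw [allocRate_eq, if_pos]
      refine Set.mem_iUnion.2 ⟨l, h1.trans (by exact_mod_cast hτ.1.le), lt_of_lt_of_le ?_ h2⟩
      exact_mod_cast hτ.2
    simpa using this

end Policy

lemma measurableSet_stoppedSet (q : ℝ → ℝ) (a b : ℝ) (e : Bool) :
    MeasurableSet (stoppedSet q a b e) :=
  MeasurableSet.iUnion fun _ =>
    (measurableSet_le measurable_const measurable_coe_real_ereal).inter
      (measurableSet_lt measurable_coe_real_ereal measurable_const)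

lemma intervalIntegral_indicator_stoppedSet_le {q : ℝ → ℝ} {a b H B : ℝ} {e : Bool} (hH : 0 ≤ H)
    (hB : 0 ≤ B) (h : volume (stoppedSet q a b e ∩ Set.Ioc 0 H) ≤ ENNReal.ofReal B) :
    ∫ s in (0 : ℝ)..H, (stoppedSet q a b e).indicator (fun _ => (1 : ℝ)) s ≤ B := by
  rw [intervalIntegral.integral_of_le hH, integral_indicator_const _
    (measurableSet_stoppedSet q a b e), smul_eq_mul, mul_one, measureReal_def,
    Measure.restrict_apply (measurableSet_stoppedSet q a b e)]
  exact ENNReal.toReal_le_of_le_ofReal hB h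

/-! ### Exponential moments of the stochastic input -/

/-- In a sequence of renewal sequences with convergent means and uniform exponential moments, the
terms centred slightly above or below the limiting mean satisfy `E exp (θ · ) ≤ 1`; the sign `s`
selects the deviation. -/
theorem exists_eventually_lintegral_exp_le_one {Ω : Type*} [MeasurableSpace Ω] {P : Measure Ω}
    [IsProbabilityMeasure P] {X : ℕ → ℕ → Ω → ℝ} {rate : ℕ → ℝ} {rate₀ δ c s : ℝ}
    (hmeas : ∀ r l, 1 ≤ r → Measurable (X r l)) (hpos : ∀ r l, 1 ≤ r → ∀ᵐ ω ∂P, 0 < X r l ω)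
    (hident : ∀ r l, 1 ≤ r → IdentDistrib (X r l) (X r 0) P P)
    (hL2 : ∀ r, 1 ≤ r → MemLp (X r 0) 2 P) (hmean : ∀ r, 1 ≤ r → ∫ ω, X r 0 ω ∂P = 1 / rate r)
    (hrate₀ : 0 < rate₀) (hrate : Tendsto rate atTop (𝓝 rate₀)) (hδ : 0 < δ)
    (hmgf : (⨆ (r : ℕ) (_ : 1 ≤ r), ∫⁻ ω, ENNReal.ofReal (Real.exp (δ * X r 0 ω)) ∂P) < ⊤)
    (hs : |s| = 1) (hsc : s * (1 / rate₀ - c) < 0) :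
    ∃ θ₀ : ℝ, 0 < θ₀ ∧ ∀ θ, 0 < θ → θ ≤ θ₀ → ∀ᶠ r in atTop, ∀ l,
      ∫⁻ ω, ENNReal.ofReal (Real.exp (θ * (s * (X r l ω - c)))) ∂P ≤ 1 := by
  set S := ⨆ (r : ℕ) (_ : 1 ≤ r), ∫⁻ ω, ENNReal.ofReal (Real.exp (δ * X r 0 ω)) ∂P
  obtain ⟨θ₀, hθ₀, h⟩ := exists_lintegral_exp_le_one P (δ := δ) (c := |c|)
    (γ := -(s * (1 / rate₀ - c)) / 2) (M := S.toReal) hδ (by linarith) ENNReal.toReal_nonneg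
  refine ⟨θ₀, hθ₀, fun θ hθ hθle => ?_⟩
  have hlim : Tendsto (fun r => s * (1 / rate r - c)) atTop (𝓝 (s * (1 / rate₀ - c))) :=
    ((tendsto_const_nhds.div hrate hrate₀.ne').sub_const c).const_mul s
  filter_upwards [eventually_ge_atTop 1,
    hlim.eventually_lt_const (show s * (1 / rate₀ - c) < s * (1 / rate₀ - c) / 2 by linarith)]
    with r hr hlt l
  have hX : Integrable (X r 0) P := (hL2 r hr).integrable (by norm_num)
  have h0 : ∫⁻ ω, ENNReal.ofReal (Real.exp (θ * (s * (X r 0 ω - c)))) ∂P ≤ 1 := by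
    refine h θ hθ hθle (fun ω => s * (X r 0 ω - c)) (X r 0)
      ((hX.sub (integrable_const c)).const_mul s) (hmeas r 0 hr) ?_ ?_ ?_
    · filter_upwards [hpos r 0 hr] with ω hω
      rw [abs_mul, hs, one_mul]
      exact (abs_sub _ _).trans (by rw [abs_of_pos hω])
    · rw [ENNReal.ofReal_toReal hmgf.ne]
      exact le_iSup₂ (f := fun (r : ℕ) (_ : 1 ≤ r) =>
        ∫⁻ ω, ENNReal.ofReal (Real.exp (δ * X r 0 ω)) ∂P) r hr
    · rw [integral_const_mul, integral_sub hX (integrable_const c), hmean r hr]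
      simp only [integral_const, probReal_univ, smul_eq_mul, one_mul]
      linarith
  have hm : Measurable fun z : ℝ => ENNReal.ofReal (Real.exp (θ * (s * (z - c)))) := by fun_prop
  exact (((hident r l hr).comp hm).lintegral_eq).trans_le h0

lemma tendsto_of_tendsto_natCast_mul_sub {a : ℕ → ℝ} {a₀ b : ℝ}
    (h : Tendsto (fun r : ℕ => (r : ℝ) * (a r - a₀)) atTop (𝓝 b)) : Tendsto a atTop (𝓝 a₀) := by
  have h1 : Tendsto (fun r : ℕ => (r : ℝ)⁻¹ * ((r : ℝ) * (a r - a₀)) + a₀) atTop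
      (𝓝 (0 * b + a₀)) := (tendsto_inv_atTop_nhds_zero_nat.mul h).add_const a₀
  rw [zero_mul, zero_add] at h1
  refine h1.congr' ?_
  filter_upwards [eventually_ge_atTop 1] with r hr
  have : (r : ℝ) ≠ 0 := by positivity
  field_simp
  ring

/-! ### Growth of powers and logarithms -/

lemma eventually_mul_rpow_le {s t c : ℝ} (a : ℝ) (hst : s < t) (hc : 0 < c) :
    ∀ᶠ r : ℕ in atTop, a * (r : ℝ) ^ s ≤ c * (r : ℝ) ^ t := by
  have h1 := ((tendsto_rpow_atTop (show 0 < t - s by linarith)).comp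
    tendsto_natCast_atTop_atTop).eventually_ge_atTop (a / c)
  filter_upwards [h1, eventually_ge_atTop 1] with r hr hr1
  have hr0 : (0 : ℝ) < r := by positivity
  simp only [Function.comp] at hr
  rw [Real.rpow_sub hr0, div_le_div_iff₀ hc (Real.rpow_pos_of_pos hr0 s)] at hr
  linarith

lemma eventually_add_mul_log_le {t c : ℝ} (a b : ℝ) (ht : 0 < t) (hc : 0 < c) :
    ∀ᶠ r : ℕ in atTop, a + b * Real.log r ≤ c * (r : ℝ) ^ t := by
  have h1 : ∀ᶠ r : ℕ in atTop, a * (r : ℝ) ^ (0 : ℝ) ≤ c / 2 * (r : ℝ) ^ t :=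
    eventually_mul_rpow_le a ht (by positivity)
  have h2 : ∀ᶠ r : ℕ in atTop, ‖Real.log r‖ ≤ c / (2 * (|b| + 1)) * ‖(r : ℝ) ^ t‖ :=
    tendsto_natCast_atTop_atTop.eventually
      ((isLittleO_log_rpow_atTop ht).bound (show 0 < c / (2 * (|b| + 1)) by positivity))
  filter_upwards [h1, h2] with r h1 h2
  rw [Real.rpow_zero, mul_one] at h1
  have h0 : (0 : ℝ) ≤ (r : ℝ) ^ t := by positivity
  rw [Real.norm_eq_abs, Real.norm_eq_abs, abs_of_nonneg h0] at h2
  have h3 : b * Real.log r ≤ |b| * |Real.log r| := by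
    rw [← abs_mul]; exact le_abs_self _
  have h4 : |b| * |Real.log r| ≤ (|b| + 1) * (c / (2 * (|b| + 1)) * (r : ℝ) ^ t) := by
    gcongr
    linarith
  have h5 : (|b| + 1) * (c / (2 * (|b| + 1)) * (r : ℝ) ^ t) = c / 2 * (r : ℝ) ^ t := by
    have : |b| + 1 ≠ 0 := by positivity
    field_simp
  linarith

/-! ### The bound on the stopped time -/

section Bound

variable {I J : ℕ} {Ω : Type*} [MeasurableSpace Ω] {P : Measure Ω} [IsProbabilityMeasure P]
  {N : Network I J} {D : Input Ω J} {p : Policy J}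

omit [IsProbabilityMeasure P] in
lemma Network.HeavyTraffic.βmin_pos (hheavy : N.HeavyTraffic D P) (j : Fin J) : 0 < N.βmin := by
  have : Nonempty (Fin J) := ⟨j⟩
  obtain ⟨i, hi⟩ := exists_eq_ciInf_of_finite (f := N.β)
  rw [Network.βmin, ← hi]
  exact hheavy.β_pos i

omit [IsProbabilityMeasure P] in
lemma Input.IsRenewal.iIndepFun_u (hD : D.IsRenewal P) {r : ℕ} (hr : 1 ≤ r) (j : Fin J) :
    iIndepFun (fun l => D.u r j l) P :=
  (hD.indep r hr).precomp (g := fun l : ℕ => Sum.inl (j, l)) fun a b hab => by simpa using hab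

omit [IsProbabilityMeasure P] in
lemma Input.IsRenewal.iIndepFun_v (hD : D.IsRenewal P) {r : ℕ} (hr : 1 ≤ r) (j : Fin J) :
    iIndepFun (fun l => D.v r j l) P :=
  (hD.indep r hr).precomp (g := fun l : ℕ => Sum.inr (j, l)) fun a b hab => by simpa using hab

/-- Levels beyond the mean interarrival time `1 / a` and the mean job size `1 / b`, such that the
allocation rate `w` still lets the queue increase. -/
lemma exists_levels {a b w : ℝ} (ha : 0 < a) (hb : 0 < b) (hw : 0 ≤ w) (h : w < a / b) :
    ∃ cU cV : ℝ, 1 / a < cU ∧ cV < 1 / b ∧ 0 < cV ∧ w * cU ≤ cV := by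
  have h1 : w / a < 1 / b := by
    rw [div_lt_div_iff₀ ha hb]
    rw [lt_div_iff₀ hb] at h
    linarith
  have h2 : 0 ≤ w / a := by positivity
  have h3 : 0 < 1 / b := by positivity
  set gap := 1 / b - w / a with hgap
  refine ⟨1 / a + gap / (2 * (w + 1)), 1 / b - gap / 2, ?_, by linarith, by linarith, ?_⟩
  · have : 0 < gap / (2 * (w + 1)) := div_pos (by linarith) (by linarith)
    linarith
  · have h4 : w * (gap / (2 * (w + 1))) ≤ gap / 2 := by
      rw [← mul_div_assoc, div_le_div_iff₀ (by linarith) (by norm_num)]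
      nlinarith
    have h5 : w * (1 / a) = w / a := by ring
    rw [mul_add, h5]
    linarith

/-- The stopped time exceeds the residual arrival time plus its typical order only if one of three
maximal gains is large: the gain from long interarrival times, from short job sizes, or from short
interarrival times. The last two also bound the number of renewals up to time `H`. -/
lemma integral_stopped_le {r : ℕ} {y : State J r} {u v : Fin J → ℕ → ℝ}
    {Q A : ℝ → Fin J → ℝ} (h : IsPolicyPath N p r y u v Q A) (hp : p.IsValid N)
    (hρ : ∀ j, 0 ≤ N.ρ j) {j : Fin J} (hu : ∀ l, 0 < u j l) (hv : ∀ l, 0 < v j l)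
    (hlohi : p.lower N r < p.upper N r) {w W H : ℝ} (hw : 0 ≤ w) (hW : 0 ≤ W) (hH : 0 ≤ H)
    (hzW : ∀ z, configRate N p z j ≤ W) (hzw : ∀ z, z j = true → configRate N p z j ≤ w) {n : ℕ}
    {cU cV c' x g d b : ℝ} (hx : 0 ≤ x) (hcU : 0 ≤ cU) (hcV : 0 ≤ cV) (hc : w * cU ≤ cV)
    (hnU : H + x + b ≤ c' * n) (hnV : W * H + x + b ≤ cV * n) (hg : 0 < g)
    (hG : g ≤ cV * (p.upper N r - p.lower N r - 2) - 1 - (1 + w) * x)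
    (hd : 1 + x + cU * (p.upper N r - min (p.lower N r) 0 + 2) ≤ d)
    (hbU : blockGain (fun l => u j l - cU) x n < b)
    (hbV : blockGain (fun l => cV - v j l) x n < b)
    (hbU' : blockGain (fun l => c' - u j l) x n < b) :
    ∫ s in (0 : ℝ)..H, (stopped N p r y Q j).indicator (fun _ => (1 : ℝ)) s ≤
      r * y.ΥA j + (((1 + w) * b / g + 2) * d + 3 * b) := by
  have hsum : ∀ (z : ℕ → ℝ) (c : ℝ), blockGain (fun l => c - z l) x n < b →
      c * n - x - b < ∑ l ∈ Finset.range n, z l := by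
    intro z c hz
    have h1 := blockGain_add_le (fun l => c - z l) hx (Nat.zero_le n)
    rw [blockGain_zero, Nat.Ico_zero_eq_range, Finset.sum_sub_distrib, Finset.sum_const,
      Finset.card_range, nsmul_eq_mul] at h1
    linarith
  have hb0 : 0 ≤ b := (blockGain_nonneg _ _ _).trans hbU.le
  have hpath := h.isThresholdPath hp hρ hu hv hlohi hw hW hH hzW hzw
    (n := n) (by linarith [hsum _ _ hbU']) (by linarith [hsum _ _ hbV])
  have hvol := hpath.volume_stoppedSet_le hx hcU hcV hc (hg.trans_le hG) hbU.le hbV.le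
  have hM : 0 ≤ p.upper N r - min (p.lower N r) 0 + 2 := by
    have := min_le_left (p.lower N r) 0; linarith
  have hcM := mul_nonneg hcU hM
  have hd0 : 0 ≤ d := by linarith
  have hΥ := mul_nonneg (Nat.cast_nonneg (α := ℝ) r) (y.ΥA_nonneg j)
  have hwb : 0 ≤ (1 + w) * b := by positivity
  refine intervalIntegral_indicator_stoppedSet_le hH (by positivity)
    (hvol.trans (ENNReal.ofReal_le_ofReal ?_))
  rw [add_assoc]
  gcongr

/-- The event of a long stopped time has at most three times the probability of a large maximal
gain. -/
lemma measure_le_integral_stopped_le (hD : D.IsRenewal P) (hp : p.IsValid N)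
    (hρ : ∀ j, 0 ≤ N.ρ j) {r : ℕ} (hr : 1 ≤ r) {y : State J r} {Q A : Ω → ℝ → Fin J → ℝ}
    (hpath : ∀ᵐ ω ∂P, IsPolicyPath N p r y (fun j l => D.u r j l ω) (fun j l => D.v r j l ω)
      (Q ω) (A ω)) {j : Fin J}
    (hlohi : p.lower N r < p.upper N r) {w W H : ℝ} (hw : 0 ≤ w) (hW : 0 ≤ W) (hH : 0 ≤ H)
    (hzW : ∀ z, configRate N p z j ≤ W) (hzw : ∀ z, z j = true → configRate N p z j ≤ w) {n : ℕ}
    {cU cV c' x g d b s θ η : ℝ} (hx : 0 ≤ x) (hcU : 0 ≤ cU) (hcV : 0 ≤ cV) (hc : w * cU ≤ cV)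
    (hnU : H + x + b ≤ c' * n) (hnV : W * H + x + b ≤ cV * n) (hg : 0 < g)
    (hG : g ≤ cV * (p.upper N r - p.lower N r - 2) - 1 - (1 + w) * x)
    (hd : 1 + x + cU * (p.upper N r - min (p.lower N r) 0 + 2) ≤ d)
    (hs : ((1 + w) * b / g + 2) * d + 3 * b < s) (hη : 0 < η)
    (hxη : Real.exp (-(θ * x)) = η ^ 2) (hθ : 0 ≤ θ)
    (hmU : ∀ l, ∫⁻ ω, ENNReal.ofReal (Real.exp (θ * (D.u r j l ω - cU))) ∂P ≤ 1)
    (hmV : ∀ l, ∫⁻ ω, ENNReal.ofReal (Real.exp (θ * (cV - D.v r j l ω))) ∂P ≤ 1)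
    (hmU' : ∀ l, ∫⁻ ω, ENNReal.ofReal (Real.exp (θ * (c' - D.u r j l ω))) ∂P ≤ 1) :
    P {ω | (r : ℝ) * y.ΥA j + s ≤
        ∫ τ in (0 : ℝ)..H, (stopped N p r y (Q ω) j).indicator (fun _ => (1 : ℝ)) τ}
      ≤ ENNReal.ofReal (3 * Real.exp (η * (n + 1) - θ * b)) := by
  have hlU : ∀ l, ∀ᵐ ω ∂P, 0 < D.u r j l ω := fun l => hD.pos_u r j l hr
  have hlV : ∀ l, ∀ᵐ ω ∂P, 0 < D.v r j l ω := fun l => hD.pos_v r j l hr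
  have hincl : ∀ᵐ ω ∂P, (r : ℝ) * y.ΥA j + s ≤
      ∫ τ in (0 : ℝ)..H, (stopped N p r y (Q ω) j).indicator (fun _ => (1 : ℝ)) τ →
      ω ∈ {ω | b ≤ blockGain (fun l => D.u r j l ω - cU) x n} ∪
        {ω | b ≤ blockGain (fun l => cV - D.v r j l ω) x n} ∪
        {ω | b ≤ blockGain (fun l => c' - D.u r j l ω) x n} := by
    filter_upwards [hpath, ae_all_iff.2 hlU, ae_all_iff.2 hlV] with ω hω hωU hωV hle
    by_contra hnot
    simp only [Set.mem_union, Set.mem_ofPred_eq, not_or, not_le] at hnot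
    obtain ⟨⟨h1, h2⟩, h3⟩ := hnot
    have := integral_stopped_le hω hp hρ hωU hωV hlohi hw hW hH hzW hzw hx hcU hcV hc hnU hnV hg
      hG hd h1 h2 h3
    linarith
  have t1 := measure_le_blockGain_le (ξ := fun l ω => D.u r j l ω - cU)
    (fun l => (hD.meas_u r j l hr).sub_const _)
    ((hD.iIndepFun_u hr j).comp (fun _ z => z - cU) fun _ => by fun_prop) hη hxη hθ hmU n b
  have t2 := measure_le_blockGain_le (ξ := fun l ω => cV - D.v r j l ω)
    (fun l => (hD.meas_v r j l hr).const_sub _)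
    ((hD.iIndepFun_v hr j).comp (fun _ z => cV - z) fun _ => by fun_prop) hη hxη hθ hmV n b
  have t3 := measure_le_blockGain_le (ξ := fun l ω => c' - D.u r j l ω)
    (fun l => (hD.meas_u r j l hr).const_sub _)
    ((hD.iIndepFun_u hr j).comp (fun _ z => c' - z) fun _ => by fun_prop) hη hxη hθ hmU' n b
  refine (measure_mono_ae hincl).trans ((measure_union_le _ _).trans
    ((add_le_add ((measure_union_le _ _).trans (add_le_add t1 t2)) t3).trans (le_of_eq ?_)))
  rw [← ENNReal.ofReal_add (by positivity) (by positivity),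
    ← ENNReal.ofReal_add (by positivity) (by positivity)]
  congr 1
  ring

set_option maxHeartbeats 800000 in
/-- The bound for a single job type. The level `b` of the gains is a small multiple of the allowed
stopped time, and the cost of a block is logarithmic in `r`, so that a crossing, with gain of order
`r ^ κ`, outweighs it. -/
theorem eventually_measure_stopped_le (hD : D.IsRenewal P) (hmgf : D.MgfBound P)
    (hheavy : N.HeavyTraffic D P) (hp : p.IsValid N) {ε : ℝ} (hε : 0 < ε) (j : Fin J) :
    ∀ᶠ r : ℕ in atTop, ∀ y : State J r, ∀ Q A : Ω → ℝ → Fin J → ℝ,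
        (∀ᵐ ω ∂P, IsPolicyPath N p r y (fun j l => D.u r j l ω) (fun j l => D.v r j l ω)
          (Q ω) (A ω)) →
      ∀ T : ℝ, 1 ≤ T →
        P {ω | (r : ℝ) * y.ΥA j + ε * T * (r : ℝ) ^ (7 / 4 * p.κ) ≤
            ∫ s in (0 : ℝ)..((r : ℝ) ^ 2 * T),
              (stopped N p r y (Q ω) j).indicator (fun _ => (1 : ℝ)) s}
          ≤ ENNReal.ofReal (Real.exp (-(1 * T * (r : ℝ) ^ (1 / 8 * p.κ)))) := by
  have hκ := hp.κ_pos
  have hκ' := hp.κ_lt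
  have hα := hheavy.α_pos j
  have hβ := hheavy.β_pos j
  have hρ : ∀ j, 0 ≤ N.ρ j := fun j =>
    (div_pos (hheavy.α_pos j) (hheavy.β_pos j)).le
  have hβm := hheavy.βmin_pos j
  obtain ⟨w, W, hw, hwρ, hW, hzW, hzw⟩ := exists_configRate_le hp hρ j
  obtain ⟨cU, cV, hcU, hcV, hcV0, hc⟩ := exists_levels hα hβ hw hwρ
  have hcU0 : 0 < cU := lt_trans (by positivity) hcU
  set c' := 1 / (2 * N.α j) with hc'
  have hc'0 : 0 < c' := by positivity
  have hc'lt : c' < 1 / N.α j := by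
    rw [hc']; apply one_div_lt_one_div_of_lt hα; linarith
  obtain ⟨δ, hδ, hmgf⟩ := hmgf
  obtain ⟨hmgfV, hmgfU⟩ := hmgf (δ / 2) (by linarith) j
  have hαlim := tendsto_of_tendsto_natCast_mul_sub (hheavy.tendsto_α j)
  have hβlim := tendsto_of_tendsto_natCast_mul_sub (hheavy.tendsto_β j)
  obtain ⟨θ₁, hθ₁, hmU⟩ := exists_eventually_lintegral_exp_le_one (P := P) (X := fun r => D.u r j)
    (c := cU) (s := 1) (fun r l => hD.meas_u r j l) (fun r l => hD.pos_u r j l)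
    (fun r l => hD.ident_u r j l) (fun r => hD.memLp_u r j) (fun r => hD.mean_u r j) hα hαlim
    (half_pos hδ) hmgfU (by simp) (by linarith)
  obtain ⟨θ₂, hθ₂, hmV⟩ := exists_eventually_lintegral_exp_le_one (P := P) (X := fun r => D.v r j)
    (c := cV) (s := -1) (fun r l => hD.meas_v r j l) (fun r l => hD.pos_v r j l)
    (fun r l => hD.ident_v r j l) (fun r => hD.memLp_v r j) (fun r => hD.mean_v r j) hβ hβlim
    (half_pos hδ) hmgfV (by simp) (by linarith)
  obtain ⟨θ₃, hθ₃, hmU'⟩ := exists_eventually_lintegral_exp_le_one (P := P)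
    (X := fun r => D.u r j)
    (c := c') (s := -1) (fun r l => hD.meas_u r j l) (fun r l => hD.pos_u r j l)
    (fun r l => hD.ident_u r j l) (fun r => hD.memLp_u r j) (fun r => hD.mean_u r j) hα hαlim
    (half_pos hδ) hmgfU (by simp) (by linarith)
  set θ := min θ₁ (min θ₂ θ₃) with hθdef
  have hθ : 0 < θ := by positivity
  replace hmU := hmU θ hθ (min_le_left _ _)
  replace hmV := hmV θ hθ ((min_le_right _ _).trans (min_le_left _ _))
  replace hmU' := hmU' θ hθ ((min_le_right _ _).trans (min_le_right _ _))
  simp only [one_mul] at hmU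
  have hneg : ∀ c z : ℝ, -1 * (z - c) = c - z := fun c z => by ring
  simp only [hneg] at hmV hmU'
  -- lower bound `g₀ r ^ κ` for the gain of a crossing, upper bound `d₀ r ^ κ` for a stop
  set g₀ := cV * (N.βmin * (p.c₂ - p.c₁)) / 2 with hg₀
  have hΔ : 0 < N.βmin * (p.c₂ - p.c₁) := mul_pos hβm (by linarith [hp.c_lt])
  have hg₀0 : 0 < g₀ := by positivity
  set d₀ := 1 + cU * (N.βmin * (|p.c₁| + |p.c₂|)) with hd₀
  have hd₀0 : 0 < d₀ := by positivity
  set ε' := ε / 2 / ((1 + w) * d₀ / g₀ + 3) with hε'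
  have hden : 0 < (1 + w) * d₀ / g₀ + 3 := by positivity
  have hε'0 : 0 < ε' := by positivity
  have hε'eq : ((1 + w) * d₀ / g₀ + 3) * ε' = ε / 2 := by
    rw [hε']; field_simp
  set c₀ := (W + 2 + ε') / min cV c' with hc₀
  have hmin0 : 0 < min cV c' := lt_min hcV0 hc'0
  have hc₀0 : 0 < c₀ := by positivity
  have hs1 : 1 / 8 * p.κ < 7 / 4 * p.κ := by linarith
  have hs2 : p.κ < 7 / 4 * p.κ := by linarith
  have hs3 : 7 / 4 * p.κ < 2 := by linarith
  filter_upwards [hmU, hmV, hmU', eventually_ge_atTop 1,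
    eventually_add_mul_log_le (2 * cV + 1) ((1 + w) * (4 / θ)) hκ hg₀0,
    eventually_add_mul_log_le (1 + 2 * cU) (4 / θ) hκ one_pos,
    eventually_mul_rpow_le (3 * d₀) hs2 (half_pos hε),
    eventually_add_mul_log_le (4 + c₀) 0 (show 0 < 7 / 4 * p.κ by linarith)
      (show 0 < θ * ε' / 2 by positivity),
    eventually_mul_rpow_le 1 hs1 (show 0 < θ * ε' / 2 by positivity)]
    with r hmU hmV hmU' hr hev1 hev2 hev3 hev4 hev5 y Q A hpath T hT
  have hr1 : (1 : ℝ) ≤ r := by exact_mod_cast hr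
  have hr0 : (0 : ℝ) < r := by linarith
  set x := 4 / θ * Real.log r with hx
  have hlog : 0 ≤ Real.log r := Real.log_nonneg hr1
  have hx0 : 0 ≤ x := by positivity
  set η := ((r : ℝ) ^ 2)⁻¹ with hη
  have hη0 : 0 < η := by positivity
  have hxη : Real.exp (-(θ * x)) = η ^ 2 := by
    have h1 : θ * x = ((4 : ℕ) : ℝ) * Real.log r := by
      rw [hx]; push_cast; field_simp
    rw [h1, Real.exp_neg, Real.exp_nat_mul, Real.exp_log hr0, hη, inv_pow, ← pow_mul]
  set b := ε' * T * (r : ℝ) ^ (7 / 4 * p.κ) with hb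
  have hT0 : 0 < T := by linarith
  have hb0 : 0 < b := by positivity
  set H := (r : ℝ) ^ 2 * T with hH
  have hH1 : (r : ℝ) ^ 2 ≤ H := le_mul_of_one_le_right (by positivity) hT
  have hH0 : 0 < H := by positivity
  have hH1' : 1 ≤ H := (one_le_pow₀ hr1).trans hH1
  have hκH : ∀ s : ℝ, s < 2 → (r : ℝ) ^ s ≤ (r : ℝ) ^ 2 := fun s hs => by
    rw [← Real.rpow_natCast]
    exact Real.rpow_le_rpow_of_exponent_le hr1 (by push_cast; linarith)
  have hxH : x ≤ H := by
    have := hκH p.κ (by linarith)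
    linarith
  have hbH : b ≤ ε' * H := by
    rw [hb, hH, mul_assoc]
    refine mul_le_mul_of_nonneg_left ?_ hε'0.le
    rw [mul_comm]
    exact mul_le_mul_of_nonneg_right (hκH _ hs3) hT0.le
  set n := ⌈c₀ * H⌉₊ with hn
  have hn1 : c₀ * H ≤ n := Nat.le_ceil _
  have hn2 : (n : ℝ) + 1 ≤ (c₀ + 2) * H := by
    have := Nat.ceil_lt_add_one (show 0 ≤ c₀ * H by positivity)
    linarith
  have hcount : ∀ c, min cV c' ≤ c → (W + 2 + ε') * H ≤ c * n := by
    intro c hc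
    calc (W + 2 + ε') * H = min cV c' * (c₀ * H) := by rw [hc₀]; field_simp
      _ ≤ c * n := by gcongr; exact hmin0.le.trans hc
  have hηn : η * (n + 1) ≤ (c₀ + 2) * T := by
    calc η * (n + 1) ≤ η * ((c₀ + 2) * H) := by gcongr
      _ = (c₀ + 2) * T := by rw [hη, hH]; field_simp
  have hdiff : p.upper N r - p.lower N r = N.βmin * (p.c₂ - p.c₁) * (r : ℝ) ^ p.κ := by
    unfold Policy.upper Policy.lower; ring
  have hrκ : 0 < (r : ℝ) ^ p.κ := by positivity
  have hlohi : p.lower N r < p.upper N r := by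
    have := mul_pos hΔ hrκ; linarith
  have hG : g₀ * (r : ℝ) ^ p.κ ≤ cV * (p.upper N r - p.lower N r - 2) - 1 - (1 + w) * x := by
    rw [hdiff]
    have h1 : cV * (N.βmin * (p.c₂ - p.c₁) * (r : ℝ) ^ p.κ) = 2 * (g₀ * (r : ℝ) ^ p.κ) := by
      rw [hg₀]; ring
    have h2 : (1 + w) * x = (1 + w) * (4 / θ) * Real.log r := by rw [hx]; ring
    rw [mul_sub, h1, h2]
    linarith
  have hd : 1 + x + cU * (p.upper N r - min (p.lower N r) 0 + 2) ≤ d₀ * (r : ℝ) ^ p.κ := by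
    have h1 : p.upper N r ≤ N.βmin * |p.c₂| * (r : ℝ) ^ p.κ := by
      unfold Policy.upper; gcongr; exact le_abs_self _
    have h2 : -(N.βmin * |p.c₁| * (r : ℝ) ^ p.κ) ≤ min (p.lower N r) 0 := by
      refine le_min ?_ (by simpa using by positivity)
      have : -(N.βmin * |p.c₁| * (r : ℝ) ^ p.κ) = N.βmin * (-|p.c₁|) * (r : ℝ) ^ p.κ := by ring
      rw [this]
      unfold Policy.lower; gcongr; exact neg_abs_le _
    have h3 : cU * (p.upper N r - min (p.lower N r) 0) ≤
        cU * (N.βmin * (|p.c₁| + |p.c₂|) * (r : ℝ) ^ p.κ) := by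
      gcongr; linarith
    have h4 : d₀ * (r : ℝ) ^ p.κ = (r : ℝ) ^ p.κ +
        cU * (N.βmin * (|p.c₁| + |p.c₂|) * (r : ℝ) ^ p.κ) := by rw [hd₀]; ring
    rw [h4]
    linarith
  have hfinal : ((1 + w) * b / (g₀ * (r : ℝ) ^ p.κ) + 2) * (d₀ * (r : ℝ) ^ p.κ) + 3 * b <
      ε * T * (r : ℝ) ^ (7 / 4 * p.κ) := by
    have h1 : ((1 + w) * b / (g₀ * (r : ℝ) ^ p.κ) + 2) * (d₀ * (r : ℝ) ^ p.κ) + 3 * b =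
        (((1 + w) * d₀ / g₀ + 3) * ε') * (T * (r : ℝ) ^ (7 / 4 * p.κ)) +
          2 * (d₀ * (r : ℝ) ^ p.κ) := by
      rw [hb]; field_simp; ring
    rw [h1, hε'eq]
    have h2 : 0 < d₀ * (r : ℝ) ^ p.κ := by positivity
    have h3 : ε / 2 * (r : ℝ) ^ (7 / 4 * p.κ) ≤ ε / 2 * (T * (r : ℝ) ^ (7 / 4 * p.κ)) := by
      gcongr; exact le_mul_of_one_le_left (by positivity) hT
    linarith
  refine (measure_le_integral_stopped_le (n := n) hD hp hρ hr hpath hlohi hw hW hH0.le hzW hzw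
    hx0 hcU0.le hcV0.le hc ?_ ?_ (mul_pos hg₀0 hrκ) hG hd hfinal hη0 hxη hθ.le hmU hmV hmU').trans
    (ENNReal.ofReal_le_ofReal ?_)
  · have h4 := hcount c' (min_le_right _ _)
    have h5 : 0 ≤ W * H := by positivity
    linarith
  · have h4 := hcount cV (min_le_left _ _)
    linarith
  -- the factor `3` is absorbed by `exp (2 T)`
  have h3 : (3 : ℝ) ≤ Real.exp (2 * T) := by
    have := Real.add_one_le_exp (2 * T); linarith
  calc 3 * Real.exp (η * (n + 1) - θ * b)
      ≤ Real.exp (2 * T) * Real.exp ((c₀ + 2) * T - θ * b) := by gcongr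
    _ = Real.exp (2 * T + ((c₀ + 2) * T - θ * b)) := by rw [Real.exp_add]
    _ ≤ Real.exp (-(1 * T * (r : ℝ) ^ (1 / 8 * p.κ))) := by
        apply Real.exp_le_exp.2
        have h4 : ((4 + c₀) + (r : ℝ) ^ (1 / 8 * p.κ)) * T ≤
            (θ * ε' * (r : ℝ) ^ (7 / 4 * p.κ)) * T := by
          gcongr
          linarith
        have h5 : θ * b = (θ * ε' * (r : ℝ) ^ (7 / 4 * p.κ)) * T := by rw [hb]; ring
        rw [h5]
        linarith

end Bound

end RSN

theorem proposition3p3 {I J : ℕ} {Ω : Type*} [MeasurableSpace Ω]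
    (P : Measure Ω) [IsProbabilityMeasure P]
    (N : RSN.Network I J) (D : RSN.Input Ω J) (p : RSN.Policy J)
    (hN : N.Basic) (hD : D.IsRenewal P) (hmgf : D.MgfBound P)
    (hheavy : N.HeavyTraffic D P) (hlocal : N.LocalTraffic) (hp : p.IsValid N) :
    ∀ ε : ℝ, 0 < ε → ∃ B R : ℝ, 0 < B ∧ 0 < R ∧
      ∀ r : ℕ, R ≤ (r : ℝ) → ∀ y : RSN.State J r,
      ∀ Q A : Ω → ℝ → Fin J → ℝ,
        (∀ᵐ ω ∂P, RSN.IsPolicyPath N p r y (fun j l => D.u r j l ω) (fun j l => D.v r j l ω)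
          (Q ω) (A ω)) →
      ∀ T : ℝ, 1 ≤ T → ∀ j : Fin J,
        P {ω | (r : ℝ) * y.ΥA j + ε * T * (r : ℝ) ^ (7 / 4 * p.κ) ≤
            ∫ s in (0 : ℝ)..((r : ℝ) ^ 2 * T),
              (RSN.stopped N p r y (Q ω) j).indicator (fun _ => (1 : ℝ)) s}
          ≤ ENNReal.ofReal (Real.exp (-(B * T * (r : ℝ) ^ (1 / 8 * p.κ)))) := by
  intro ε hε
  obtain ⟨R, hR⟩ := eventually_atTop.1 (eventually_all.2 fun j =>
    RSN.eventually_measure_stopped_le hD hmgf hheavy hp hε j)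
  refine ⟨1, max R 1, one_pos, by positivity, fun r hr y Q A hpath T hT j => ?_⟩
  exact hR r (by exact_mod_cast (le_max_left _ _).trans hr) j y Q A hpath T hT
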